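/- For every even integer $N\ge 2$ let $\mathcal H_N=\mathbb C^N$ with its standard Hermitian inner product (antilinear in the first argument) and the position basis $\mathbf q_0,\dots,\mathbf q_{N-1}$. Let $(\hat F_N)_{kj}=N^{-1/2}e^{-2\pi i kj/N}$, $0\le k,j<N$, be the discrete Fourier transform, and let $$\hat B_N=\hat F_N^{-1}\begin{pmatrix}\hat F_{N/2}&0\\0&\hat F_{N/2}\end{pmatrix}$$ be the quantised baker's map. For $\mathbf k=(k_1,k_2)\in\mathbb Z^2$ let $T(\mathbf k)$ be the quantum translation on $\mathcal H_N$, $(T(\mathbf k)\psi)_n=e^{-\pi i k_1k_2/N}e^{2\pi i k_2 n/N}\psi_{n-k_1}$ (indices modulo $N$), and for $a\in C^\infty(\mathbb T^2)$, $\mathbb T^2=\mathbb R^2/\mathbb Z^2$, with Fourier expansion $a(q,p)=\sum_{\mathbf k\in\mathbb Z^2}\tilde a(\mathbf k)\,e^{2\pi i(qk_2-pk_1)}$, let $\mathrm{Op}^{\rm W}_N(a)=\sum_{\mathbf k\in\mathbb Z^2}\tilde a(\mathbf k)\,T(\mathbf k)$ be its Weyl quantisation. For every even $N\ge2$ let $\varphi_{N,1},\dots,\varphi_{N,N}$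 be an arbitrary orthonormal basis of $\mathcal H_N$ consisting of eigenvectors of $\hat B_N$. Then for each even $N\ge 2$ there exists a non-empty subset $J_N\subset\{1,\dots,N\}$, with $\#J_N/N\to1$ as $N\to\infty$, such that for every $a\in C^\infty(\mathbb T^2)$ and every sequence $(j_N)_{N\in 2\mathbb N}$ with $j_N\in J_N$, $$\lim_{N\to\infty}\big\langle\varphi_{N,j_N},\mathrm{Op}^{\rm W}_N(a)\,\varphi_{N,j_N}\big\rangle=\int_{\mathbb T^2}a(\mathbf x)\,d\mathbf x .$$ The sets $J_N$ do not depend on $a$ or on the sequence. -/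

import Mathlib

open Filter Topology MeasureTheory
open scoped ContDiff

noncomputable section

namespace QuantumBaker

/-- The admissible inverse Planck constants `N ∈ {2, 4, 6, …}`. -/
abbrev EvenPos : Type := {N : ℕ // 0 < N ∧ Even N}

/-- `a ∈ C^∞(𝕋²)`: a smooth complex function of `x = (q, p) ∈ ℝ²` which is `ℤ²`-periodic. -/
structure IsSmoothOnTorus (a : ℝ × ℝ → ℂ) : Prop where
  contDiff : ContDiff ℝ ∞ a
  periodic : ∀ (q p : ℝ) (m n : ℤ), a (q + m, p + n) = a (q, p)

/-- The integral over the torus, identified with the square `[0,1) × [0,1)`. -/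
def torusIntegral (a : ℝ × ℝ → ℂ) : ℂ :=
  ∫ x in Set.Ico (0 : ℝ) 1 ×ˢ Set.Ico (0 : ℝ) 1, a x

/-- The Fourier mode `e_k(q, p) = exp (2πi (q k₂ - p k₁))`. -/
def fourierMode (k : ℤ × ℤ) (x : ℝ × ℝ) : ℂ :=
  Complex.exp (2 * Real.pi * Complex.I * (x.1 * k.2 - x.2 * k.1))

/-- The coefficient of `e_k` in the Fourier expansion of `a`. -/
def torusFourierCoeff (a : ℝ × ℝ → ℂ) (k : ℤ × ℤ) : ℂ :=
  torusIntegral fun x => (starRingEnd ℂ) (fourierMode k x) * a x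

/-- The `N`-dimensional quantum space, in the orthonormal position basis `𝐪₀, …, 𝐪_{N-1}`.
The vector `ψ` is the distribution
`N ^ (-1/2) * ∑_{j < N} ∑_{ν ∈ ℤ} ψ_j δ(q - j/N + ν)` on the line. -/
abbrev QState (N : ℕ) : Type := EuclideanSpace ℂ (Fin N)

/-- The quantum translation `T(k) = T̂_{k/N}` on the quantum space, in the position basis, where
`T̂_v = exp (i (v₂ q̂ - v₁ p̂) / ħ)`, that is,
`(T̂_v ψ)(q) = exp (-i v₁ v₂ / (2ħ)) * exp (i v₂ q / ħ) * ψ (q - v₁)`, with `ħ = 1 / (2πN)`.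
For `v = k/N` and at the point `q = i/N` this reads
`(T(k) ψ)_i = exp (-πi k₁ k₂ / N) * exp (2πi k₂ i / N) * ψ_{i - k₁}` (index modulo `N`). -/
def weylTranslation (N : ℕ) (k : ℤ × ℤ) : Matrix (Fin N) (Fin N) ℂ :=
  Matrix.of fun i j =>
    if ((i : ℕ) : ℤ) ≡ ((j : ℕ) : ℤ) + k.1 [ZMOD (N : ℤ)] then
      Complex.exp (-(Real.pi * Complex.I * (k.1 * k.2) / N)) *
        Complex.exp (2 * Real.pi * Complex.I * (k.2 * ((i : ℕ) : ℂ)) / N)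
    else 0

/-- The Weyl quantisation `Op^W_N(a) = ∑_{k ∈ ℤ²} ã(k) T(k)`. -/
def weylOp (N : ℕ) (a : ℝ × ℝ → ℂ) : Matrix (Fin N) (Fin N) ℂ :=
  ∑' k : ℤ × ℤ, torusFourierCoeff a k • weylTranslation N k

/-- The discrete Fourier transform, `(F_N)_{kj} = N ^ (-1/2) * exp (-2πi k j / N)`. -/
def dft (N : ℕ) : Matrix (Fin N) (Fin N) ℂ :=
  Matrix.of fun k j =>
    1 / (Real.sqrt N : ℂ) *
      Complex.exp (-(2 * Real.pi * Complex.I * (((k : ℕ) : ℂ) * ((j : ℕ) : ℂ)) / N))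

/-- The splitting of `{0, …, N-1}` into its lower and its upper half, for even `N`. -/
def halves (N : EvenPos) : Fin (N.1 / 2) ⊕ Fin (N.1 / 2) ≃ Fin N.1 :=
  finSumFinEquiv.trans (finCongr (by have := Nat.div_two_mul_two_of_even N.2.2; omega))

/-- The block matrix `diag (F_{N/2}, F_{N/2})`. -/
def bakerMix (N : EvenPos) : Matrix (Fin N.1) (Fin N.1) ℂ :=
  (Matrix.fromBlocks (dft (N.1 / 2)) 0 0 (dft (N.1 / 2))).reindex (halves N) (halves N)

/-- The quantised baker's map of Balazs and Voros, `B_N = F_N⁻¹ diag (F_{N/2}, F_{N/2})`. -/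
def bakerOp (N : EvenPos) : Matrix (Fin N.1) (Fin N.1) ℂ :=
  (dft N.1)⁻¹ * bakerMix N

/-- The diagonal matrix element `⟨ψ, Aψ⟩` of an operator given by its matrix in the position
basis. The inner product is antilinear in its first argument. -/
def expectation {N : ℕ} (A : Matrix (Fin N) (Fin N) ℂ) (ψ : QState N) : ℂ :=
  inner ℂ ψ (Matrix.toEuclideanLin A ψ)

end QuantumBaker

end

/-! The size of operators is measured in the normalised Hilbert–Schmidt norm `hs`, which is
unitarily invariant and in which the identity has norm 1. It is weak enough to ignore the
discontinuities of the baker's map: errors confined to o(N) columns, each of bounded norm, vanish in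
the limit. It is strong enough for the goal, because by Cauchy–Schwarz it controls the mean over any
orthonormal basis of the absolute values of the diagonal matrix elements (`meanDev_le`).

In this norm the evolution follows the classical map q ↦ 2q mod 1, p ↦ (p + [2q])/2. The position
function e(mq), m an integer, becomes e(2mq) up to a vanishing error (`hs_heis_clock_sub_le`). The
momentum function e(κp) becomes a position function times e(κp/2), since conjugation by the block
Fourier transform fixes operators that are scalar on each half (`heis_momClock`,
`blk_momClock_asympEq`). After t steps the momentum frequency is κ/2^t, and the momentum factor is
close to the identity (`hs_momClock_sub_one_le`). Every product e(mq)e(κp) is therefore carried, at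
a fixed large time, close to a pure position observable.

Diagonal elements in an eigenbasis and traces do not change under evolution, so only position
observables need to be treated. For these, averaging over n time steps suffices: the matrices of
e(2^t m q), t < n, m ≠ 0, are orthogonal for large N, so their sum has norm √n and their average
n^(-1/2) (`clockSeq_mem_ergodicSeqs`). This mixing argument replaces an ergodic theorem. Time is
fixed before N → ∞ throughout.

Hence for each k ≠ 0 the diagonal elements of T(k) tend to zero in mean. To obtain sets independent
of the observable, these elements are summed over all k with summable weights, and Markov's
inequality is applied to the single resulting deviation (`one_sub_sqrt_le_card_goodIndices`).
Absolute summability of the Fourier coefficients of a smooth function then gives the limit for every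
observable by dominated convergence. -/

noncomputable section

namespace QuantumBaker

/-! ### The normalised Hilbert–Schmidt norm -/

section HilbertSchmidt

variable {ι : Type*} [Fintype ι]

/-- The squared Hilbert–Schmidt norm. -/
def hsSq (A : Matrix ι ι ℂ) : ℝ := ∑ i, ∑ j, ‖A i j‖ ^ 2

/-- The normalised Hilbert–Schmidt norm. -/
def hs (A : Matrix ι ι ℂ) : ℝ := Real.sqrt (hsSq A / Fintype.card ι)

lemma hsSq_nonneg (A : Matrix ι ι ℂ) : 0 ≤ hsSq A := by
  unfold hsSq; positivity

lemma hs_nonneg (A : Matrix ι ι ℂ) : 0 ≤ hs A := Real.sqrt_nonneg _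

section Frobenius

attribute [local instance] Matrix.frobeniusNormedAddCommGroup

lemma hsSq_eq_frobenius (A : Matrix ι ι ℂ) : Real.sqrt (hsSq A) = ‖A‖ := by
  rw [Matrix.frobenius_norm_def, Real.sqrt_eq_rpow, hsSq]
  simp

lemma hs_eq_frobenius (A : Matrix ι ι ℂ) : hs A = ‖A‖ / Real.sqrt (Fintype.card ι) := by
  rw [hs, Real.sqrt_div (hsSq_nonneg A), hsSq_eq_frobenius]

lemma hs_add_le (A B : Matrix ι ι ℂ) : hs (A + B) ≤ hs A + hs B := by
  simp only [hs_eq_frobenius, ← add_div]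
  gcongr
  exact norm_add_le A B

end Frobenius

lemma hs_smul (c : ℂ) (A : Matrix ι ι ℂ) : hs (c • A) = ‖c‖ * hs A := by
  have h : hsSq (c • A) = ‖c‖ ^ 2 * hsSq A := by
    simp [hsSq, Finset.mul_sum, mul_pow]
  rw [hs, hs, h, mul_div_assoc, Real.sqrt_mul (by positivity), Real.sqrt_sq (norm_nonneg c)]

lemma hs_neg (A : Matrix ι ι ℂ) : hs (-A) = hs A := by
  simpa using hs_smul (-1) A

@[simp] lemma hs_zero : hs (0 : Matrix ι ι ℂ) = 0 := by
  simp [hs, hsSq]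

lemma hs_sub_comm (A B : Matrix ι ι ℂ) : hs (A - B) = hs (B - A) := by
  rw [← hs_neg, neg_sub]

lemma hs_sub_le (A B C : Matrix ι ι ℂ) : hs (A - C) ≤ hs (A - B) + hs (B - C) := by
  simpa using hs_add_le (A - B) (B - C)

lemma hs_sum_le {κ : Type*} (s : Finset κ) (A : κ → Matrix ι ι ℂ) :
    hs (∑ k ∈ s, A k) ≤ ∑ k ∈ s, hs (A k) := by
  classical
  induction s using Finset.induction_on with
  | empty => simp
  | insert a s ha ih =>
    rw [Finset.sum_insert ha, Finset.sum_insert ha]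
    exact (hs_add_le _ _).trans (by gcongr)

lemma hsSq_eq_trace (A : Matrix ι ι ℂ) : (hsSq A : ℂ) = (A.conjTranspose * A).trace := by
  simp only [hsSq, Matrix.trace, Matrix.diag_apply, Matrix.mul_apply, Matrix.conjTranspose_apply]
  rw [Finset.sum_comm]
  push_cast
  refine Finset.sum_congr rfl fun j _ => Finset.sum_congr rfl fun i _ => ?_
  rw [← starRingEnd_apply, mul_comm, Complex.mul_conj']

variable [DecidableEq ι]

lemma hs_unitary_mul {U : Matrix ι ι ℂ} (hU : U ∈ Matrix.unitaryGroup ι ℂ) (A : Matrix ι ι ℂ) :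
    hs (U * A) = hs A := by
  have h : hsSq (U * A) = hsSq A := by
    have := Matrix.mem_unitaryGroup_iff'.1 hU
    rw [Matrix.star_eq_conjTranspose] at this
    apply Complex.ofReal_injective
    rw [hsSq_eq_trace, hsSq_eq_trace, Matrix.conjTranspose_mul, Matrix.mul_assoc,
      ← Matrix.mul_assoc _ U A, this, Matrix.one_mul]
  rw [hs, hs, h]

lemma hs_mul_unitary {U : Matrix ι ι ℂ} (hU : U ∈ Matrix.unitaryGroup ι ℂ) (A : Matrix ι ι ℂ) :
    hs (A * U) = hs A := by
  have h : hsSq (A * U) = hsSq A := by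
    have := Matrix.mem_unitaryGroup_iff.1 hU
    rw [Matrix.star_eq_conjTranspose] at this
    apply Complex.ofReal_injective
    rw [hsSq_eq_trace, hsSq_eq_trace, Matrix.conjTranspose_mul, Matrix.trace_mul_comm,
      Matrix.mul_assoc, ← Matrix.mul_assoc U, this, Matrix.one_mul, Matrix.trace_mul_comm]
  rw [hs, hs, h]

lemma hsSq_diagonal (d : ι → ℂ) : hsSq (Matrix.diagonal d) = ∑ i, ‖d i‖ ^ 2 := by
  refine Finset.sum_congr rfl fun i _ => ?_
  rw [Finset.sum_eq_single i]
  · simp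
  · intro j _ hj
    simp [Matrix.diagonal_apply_ne' _ hj]
  · simp

lemma hs_diagonal (d : ι → ℂ) :
    hs (Matrix.diagonal d) = Real.sqrt ((∑ i, ‖d i‖ ^ 2) / Fintype.card ι) := by
  rw [hs, hsSq_diagonal]

lemma hs_diagonal_le {d : ι → ℂ} {C : ℝ} (hC : 0 ≤ C) (h : ∀ i, ‖d i‖ ≤ C) :
    hs (Matrix.diagonal d) ≤ C := by
  rw [hs_diagonal]
  apply Real.sqrt_le_iff.2 ⟨hC, ?_⟩
  apply div_le_of_le_mul₀ (by positivity) (by positivity)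
  calc ∑ i, ‖d i‖ ^ 2 ≤ ∑ _i : ι, C ^ 2 := by gcongr with i; exact h i
    _ = C ^ 2 * Fintype.card ι := by simp [mul_comm]

end HilbertSchmidt

/-! ### Exponentials -/

/-- `e x = exp (2 π i x)`. -/
def e (x : ℝ) : ℂ := Complex.exp (2 * Real.pi * Complex.I * x)

lemma e_add (x y : ℝ) : e (x + y) = e x * e y := by
  rw [e, e, e, ← Complex.exp_add]; push_cast; ring_nf

@[simp] lemma e_zero : e 0 = 1 := by simp [e]

@[simp] lemma e_int (m : ℤ) : e m = 1 := by
  rw [e, Complex.exp_eq_one_iff]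
  exact ⟨m, by push_cast; ring⟩

lemma e_eq_one_iff (x : ℝ) : e x = 1 ↔ ∃ m : ℤ, x = m := by
  constructor
  · intro h
    rw [e, Complex.exp_eq_one_iff] at h
    obtain ⟨m, hm⟩ := h
    refine ⟨m, ?_⟩
    have : (2 * Real.pi * Complex.I) * (x : ℂ) = (2 * Real.pi * Complex.I) * (m : ℂ) := by
      rw [hm]; ring
    have := mul_left_cancel₀ Complex.two_pi_I_ne_zero this
    exact_mod_cast this
  · rintro ⟨m, rfl⟩; exact e_int m

lemma e_eq_e_of_int {x y : ℝ} (m : ℤ) (h : x = y + m) : e x = e y := by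
  rw [h, e_add, e_int, mul_one]

@[simp] lemma norm_e (x : ℝ) : ‖e x‖ = 1 := by
  rw [e, show 2 * Real.pi * Complex.I * x = ((2 * Real.pi * x : ℝ) : ℂ) * Complex.I by
    push_cast; ring, Complex.norm_exp_ofReal_mul_I]

lemma star_e (x : ℝ) : star (e x) = e (-x) := by
  rw [e, e, ← starRingEnd_apply, ← Complex.exp_conj]
  congr 1
  rw [show 2 * Real.pi * Complex.I * x = ((2 * Real.pi * x : ℝ) : ℂ) * Complex.I by
    push_cast; ring, map_mul, Complex.conj_I, Complex.conj_ofReal]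
  push_cast
  ring

lemma e_mul_neg (x : ℝ) : e x * e (-x) = 1 := by
  rw [← e_add]; simp

lemma e_pow (x : ℝ) (n : ℕ) : e x ^ n = e (n * x) := by
  rw [e, e, ← Complex.exp_nat_mul]; push_cast; ring_nf

lemma norm_e_sub_one_le (x : ℝ) : ‖e x - 1‖ ≤ 2 * Real.pi * |x| := by
  have h := Real.norm_exp_I_mul_ofReal_sub_one_le (x := 2 * Real.pi * x)
  rw [e, show 2 * Real.pi * Complex.I * x = Complex.I * ((2 * Real.pi * x : ℝ) : ℂ) by
    push_cast; ring]
  refine h.trans (le_of_eq ?_)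
  rw [Real.norm_eq_abs, abs_mul, abs_of_pos Real.two_pi_pos]

lemma continuous_e : Continuous e := by
  unfold e; fun_prop

/-- Orthogonality of the characters of `ℤ/M`. -/
lemma sum_e_eq_zero {M : ℕ} (hM : 0 < M) {m : ℤ} (hm : ¬ (M : ℤ) ∣ m) :
    ∑ n : Fin M, e (m * (n : ℕ) / M) = 0 := by
  have hM' : (M : ℝ) ≠ 0 := by positivity
  have h1 : e (m / M) ≠ 1 := by
    rw [Ne, e_eq_one_iff]
    rintro ⟨l, hl⟩
    apply hm
    rw [div_eq_iff hM'] at hl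
    exact ⟨l, by rw [mul_comm]; exact_mod_cast hl⟩
  have h2 : ∀ n : ℕ, e (m * n / M) = e (m / M) ^ n := by
    intro n; rw [e_pow]; congr 1; ring
  simp only [h2]
  rw [Fin.sum_univ_eq_sum_range (fun n => e (m / M) ^ n) M, geom_sum_eq h1, e_pow,
    mul_div_cancel₀ _ hM', e_int]
  simp

/-! ### Fourier transform, clock and shift matrices -/

lemma unitaryGroup_conjTranspose {ι : Type*} [Fintype ι] [DecidableEq ι] {U : Matrix ι ι ℂ}
    (hU : U ∈ Matrix.unitaryGroup ι ℂ) : U.conjTranspose ∈ Matrix.unitaryGroup ι ℂ :=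
  Unitary.star_mem hU

lemma conjTranspose_mul_self_of_unitary {ι : Type*} [Fintype ι] [DecidableEq ι] {U : Matrix ι ι ℂ}
    (hU : U ∈ Matrix.unitaryGroup ι ℂ) : U.conjTranspose * U = 1 :=
  Matrix.mem_unitaryGroup_iff'.1 hU

lemma mul_conjTranspose_self_of_unitary {ι : Type*} [Fintype ι] [DecidableEq ι] {U : Matrix ι ι ℂ}
    (hU : U ∈ Matrix.unitaryGroup ι ℂ) : U * U.conjTranspose = 1 :=
  Matrix.mem_unitaryGroup_iff.1 hU

/-- The diagonal matrix of the function `e (κ q)` sampled at the points `q = n / M`. -/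
def clock (M : ℕ) (κ : ℝ) : Matrix (Fin M) (Fin M) ℂ :=
  Matrix.diagonal fun n => e (κ * (n : ℕ) / M)

/-- The cyclic shift by `m`. -/
def shift (M : ℕ) (m : ℤ) : Matrix (Fin M) (Fin M) ℂ :=
  Matrix.of fun i j => if ((i : ℕ) : ℤ) ≡ ((j : ℕ) : ℤ) + m [ZMOD (M : ℤ)] then 1 else 0

@[simp] lemma clock_zero (M : ℕ) : clock M 0 = 1 := by
  simp [clock]

lemma clock_add (M : ℕ) (κ μ : ℝ) : clock M (κ + μ) = clock M κ * clock M μ := by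
  rw [clock, clock, clock, Matrix.diagonal_mul_diagonal]
  congr 1
  funext n
  rw [← e_add]
  congr 1
  ring

lemma clock_conjTranspose (M : ℕ) (κ : ℝ) : (clock M κ).conjTranspose = clock M (-κ) := by
  rw [clock, clock, Matrix.diagonal_conjTranspose]
  congr 1
  funext n
  rw [Pi.star_apply, star_e]
  congr 1
  ring

lemma clock_unitary (M : ℕ) (κ : ℝ) : clock M κ ∈ Matrix.unitaryGroup (Fin M) ℂ := by
  rw [Matrix.mem_unitaryGroup_iff, Matrix.star_eq_conjTranspose, clock_conjTranspose, ← clock_add]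
  simp

lemma dft_apply (M : ℕ) (k j : Fin M) :
    dft M k j = 1 / (Real.sqrt M : ℂ) * e (-((k : ℕ) * (j : ℕ)) / M) := by
  rw [dft, Matrix.of_apply, e]
  congr 2
  push_cast
  ring

lemma inv_sqrt_mul_inv_sqrt {M : ℕ} :
    (1 / (Real.sqrt M : ℂ)) * (1 / (Real.sqrt M : ℂ)) = 1 / (M : ℂ) := by
  rw [div_mul_div_comm, one_mul, ← Complex.ofReal_mul, Real.mul_self_sqrt (by positivity)]
  simp

lemma dft_unitary (M : ℕ) : dft M ∈ Matrix.unitaryGroup (Fin M) ℂ := by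
  rw [Matrix.mem_unitaryGroup_iff', Matrix.star_eq_conjTranspose]
  ext i j
  have hM : 0 < M := i.pos
  rw [Matrix.mul_apply]
  have h : ∀ k : Fin M, (dft M).conjTranspose i k * dft M k j =
      1 / (M : ℂ) * e (((i : ℤ) - (j : ℤ) : ℤ) * (k : ℕ) / M) := by
    intro k
    have hs : star (1 / (Real.sqrt M : ℂ)) = 1 / (Real.sqrt M : ℂ) := by
      rw [← starRingEnd_apply, map_div₀, map_one, Complex.conj_ofReal]
    rw [Matrix.conjTranspose_apply, dft_apply, dft_apply, star_mul', hs, star_e,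
      mul_mul_mul_comm, inv_sqrt_mul_inv_sqrt, ← e_add]
    congr 2
    push_cast
    ring
  simp only [h]
  rw [← Finset.mul_sum]
  by_cases hij : i = j
  · subst hij
    have : (M : ℂ) ≠ 0 := by exact_mod_cast hM.ne'
    simp [this]
  · rw [sum_e_eq_zero hM, Matrix.one_apply_ne hij, mul_zero]
    intro hd
    apply hij
    have h1 := i.2
    have h2 := j.2
    have := Int.eq_zero_of_abs_lt_dvd hd (by rw [abs_lt]; constructor <;> omega)
    ext
    omega

/-- A sum over one residue class modulo `M` inside `{0, …, M-1}`. -/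
lemma sum_ite_modEq {M : ℕ} (hM : 0 < M) (z : ℤ) (f : Fin M → ℂ) (c : ℂ)
    (hf : ∀ l : Fin M, ((l : ℕ) : ℤ) ≡ z [ZMOD (M : ℤ)] → f l = c) :
    ∑ l : Fin M, (if ((l : ℕ) : ℤ) ≡ z [ZMOD (M : ℤ)] then f l else 0) = c := by
  have hM' : (0 : ℤ) < M := by exact_mod_cast hM
  have h0 := Int.emod_nonneg z hM'.ne'
  have h1 := Int.emod_lt_of_pos z hM'
  have hl : (z % M).toNat < M := by omega
  have hmod : (((⟨(z % M).toNat, hl⟩ : Fin M) : ℕ) : ℤ) ≡ z [ZMOD (M : ℤ)] := by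
    simp only [Int.toNat_of_nonneg h0]
    exact Int.mod_modEq z M
  rw [Finset.sum_eq_single ⟨(z % M).toNat, hl⟩, if_pos hmod, hf _ hmod]
  · intro b _ hb
    rw [if_neg]
    intro h
    apply hb
    have hb2 : ((b : ℕ) : ℤ) % M = z % M := h
    rw [Int.emod_eq_of_lt (by positivity) (by exact_mod_cast b.2)] at hb2
    ext
    simp only
    omega
  · simp

lemma sum_shift_mul {M : ℕ} (hM : 0 < M) (m : ℤ) (k : Fin M) (f : Fin M → ℂ) (c : ℂ)
    (hf : ∀ l : Fin M, ((l : ℕ) : ℤ) ≡ (k : ℕ) - m [ZMOD (M : ℤ)] → f l = c) :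
    ∑ l, shift M m k l * f l = c := by
  rw [← sum_ite_modEq hM (((k : ℕ) : ℤ) - m) f c hf]
  refine Finset.sum_congr rfl fun l _ => ?_
  rw [shift, Matrix.of_apply]
  have : (((k : ℕ) : ℤ) ≡ ((l : ℕ) : ℤ) + m [ZMOD (M : ℤ)]) ↔
      (((l : ℕ) : ℤ) ≡ (k : ℕ) - m [ZMOD (M : ℤ)]) := by
    constructor
    · intro h
      simpa using (h.sub_right m).symm
    · intro h
      simpa using (h.add_right m).symm
  simp only [this]
  split_ifs <;> simp

lemma sum_mul_shift {M : ℕ} (hM : 0 < M) (m : ℤ) (j : Fin M) (f : Fin M → ℂ) (c : ℂ)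
    (hf : ∀ l : Fin M, ((l : ℕ) : ℤ) ≡ (j : ℕ) + m [ZMOD (M : ℤ)] → f l = c) :
    ∑ l, f l * shift M m l j = c := by
  rw [← sum_ite_modEq hM (((j : ℕ) : ℤ) + m) f c hf]
  refine Finset.sum_congr rfl fun l _ => ?_
  rw [shift, Matrix.of_apply]
  split_ifs <;> simp

/-- Integrality of the frequency makes the phase depend only on indices modulo `M`; a clock of
non-integral frequency has no cyclic shift as its Fourier transform. -/
lemma dft_mul_clock {M : ℕ} (m : ℤ) : dft M * clock M m = shift M m * dft M := by
  ext k j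
  have hM : 0 < M := k.pos
  have hM' : (M : ℝ) ≠ 0 := by positivity
  rw [clock, Matrix.mul_diagonal, Matrix.mul_apply]
  symm
  apply sum_shift_mul hM
  intro l hl
  obtain ⟨t, ht⟩ := hl.dvd
  rw [dft_apply, dft_apply, mul_assoc, ← e_add]
  congr 1
  refine e_eq_e_of_int (t * (j : ℕ)) ?_
  have ht' : ((k : ℕ) : ℝ) - m - (l : ℕ) = M * t := by exact_mod_cast ht
  have hl' : ((l : ℕ) : ℝ) = (k : ℕ) - m - M * t := by linarith
  rw [hl']
  push_cast
  field_simp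
  ring

lemma clock_mul_dft {M : ℕ} (m : ℤ) : clock M m * dft M = dft M * shift M (-m) := by
  ext k j
  have hM : 0 < M := k.pos
  have hM' : (M : ℝ) ≠ 0 := by positivity
  rw [clock, Matrix.diagonal_mul, Matrix.mul_apply]
  symm
  apply sum_mul_shift hM
  intro l hl
  obtain ⟨t, ht⟩ := hl.dvd
  rw [dft_apply, dft_apply, mul_left_comm, ← e_add]
  congr 1
  refine e_eq_e_of_int (t * (k : ℕ)) ?_
  have ht' : ((j : ℕ) : ℝ) + (-m) - (l : ℕ) = M * t := by exact_mod_cast ht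
  have hl' : ((l : ℕ) : ℝ) = (j : ℕ) - m - M * t := by linarith
  rw [hl']
  push_cast
  field_simp
  ring

lemma shift_eq_conj_clock {M : ℕ} (m : ℤ) :
    shift M m = dft M * clock M m * (dft M).conjTranspose := by
  rw [dft_mul_clock, Matrix.mul_assoc, mul_conjTranspose_self_of_unitary (dft_unitary M),
    Matrix.mul_one]

lemma shift_neg_eq_conj_clock {M : ℕ} (m : ℤ) :
    shift M (-m) = (dft M).conjTranspose * clock M m * dft M := by
  rw [Matrix.mul_assoc, clock_mul_dft, ← Matrix.mul_assoc,
    conjTranspose_mul_self_of_unitary (dft_unitary M), Matrix.one_mul]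

lemma shift_unitary (M : ℕ) (m : ℤ) : shift M m ∈ Matrix.unitaryGroup (Fin M) ℂ := by
  rw [shift_eq_conj_clock]
  exact mul_mem (mul_mem (dft_unitary M) (clock_unitary M m))
    (unitaryGroup_conjTranspose (dft_unitary M))

lemma trace_clock {M : ℕ} {m : ℤ} (hm : ¬ (M : ℤ) ∣ m) (hM : 0 < M) :
    (clock M m).trace = 0 := by
  rw [clock, Matrix.trace_diagonal, sum_e_eq_zero hM hm]

section Baker

/-! ### Block matrices and the baker's map -/

lemma EvenPos.two_mul_half (N : EvenPos) : 2 * (N.1 / 2) = N.1 :=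
  Nat.two_mul_div_two_of_even N.2.2

lemma EvenPos.half_pos (N : EvenPos) : 0 < N.1 / 2 := by
  have := N.two_mul_half
  have := N.2.1
  omega

lemma EvenPos.cast_eq (N : EvenPos) : (N.1 : ℝ) = 2 * ((N.1 / 2 : ℕ) : ℝ) := by
  exact_mod_cast N.two_mul_half.symm

@[simp] lemma halves_inl (N : EvenPos) (i : Fin (N.1 / 2)) :
    ((halves N (Sum.inl i) : Fin N.1) : ℕ) = i := by
  simp [halves]

@[simp] lemma halves_inr (N : EvenPos) (i : Fin (N.1 / 2)) :
    ((halves N (Sum.inr i) : Fin N.1) : ℕ) = N.1 / 2 + i := by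
  simp [halves, add_comm]

/-- The block matrix `X ⊕ X`. -/
def blk (N : EvenPos) (X : Matrix (Fin (N.1 / 2)) (Fin (N.1 / 2)) ℂ) :
    Matrix (Fin N.1) (Fin N.1) ℂ :=
  (Matrix.fromBlocks X 0 0 X).reindex (halves N) (halves N)

variable {N : EvenPos} (X Y : Matrix (Fin (N.1 / 2)) (Fin (N.1 / 2)) ℂ)

lemma blk_apply (s t : Fin (N.1 / 2) ⊕ Fin (N.1 / 2)) :
    blk N X (halves N s) (halves N t) = Matrix.fromBlocks X 0 0 X s t := by
  simp [blk]

lemma matrix_ext_halves {A B : Matrix (Fin N.1) (Fin N.1) ℂ}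
    (h : ∀ s t, A (halves N s) (halves N t) = B (halves N s) (halves N t)) : A = B := by
  ext i j
  obtain ⟨s, rfl⟩ := (halves N).surjective i
  obtain ⟨t, rfl⟩ := (halves N).surjective j
  exact h s t

lemma blk_mul : blk N (X * Y) = blk N X * blk N Y := by
  simp only [blk, Matrix.reindex_apply]
  rw [Matrix.submatrix_mul_equiv, Matrix.fromBlocks_multiply]
  simp

lemma blk_one : blk N 1 = 1 := by
  simp [blk]

lemma blk_conjTranspose : blk N X.conjTranspose = (blk N X).conjTranspose := by
  simp [blk, Matrix.fromBlocks_conjTranspose]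

lemma blk_sub : blk N (X - Y) = blk N X - blk N Y := by
  apply matrix_ext_halves
  rintro (s | s) (t | t) <;> simp [blk_apply]

lemma blk_add : blk N (X + Y) = blk N X + blk N Y := by
  apply matrix_ext_halves
  rintro (s | s) (t | t) <;> simp [blk_apply]

lemma blk_smul (c : ℂ) : blk N (c • X) = c • blk N X := by
  apply matrix_ext_halves
  rintro (s | s) (t | t) <;> simp [blk_apply]

lemma blk_sum {κ : Type*} (s : Finset κ)
    (f : κ → Matrix (Fin (N.1 / 2)) (Fin (N.1 / 2)) ℂ) :
    blk N (∑ k ∈ s, f k) = ∑ k ∈ s, blk N (f k) := by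
  let L : Matrix (Fin (N.1 / 2)) (Fin (N.1 / 2)) ℂ →+ Matrix (Fin N.1) (Fin N.1) ℂ :=
    AddMonoidHom.mk' (blk N) fun X Y => blk_add X Y
  exact map_sum L f s

variable {X} in
lemma blk_unitary (hX : X ∈ Matrix.unitaryGroup _ ℂ) : blk N X ∈ Matrix.unitaryGroup _ ℂ := by
  rw [Matrix.mem_unitaryGroup_iff, Matrix.star_eq_conjTranspose, ← blk_conjTranspose, ← blk_mul,
    mul_conjTranspose_self_of_unitary hX, blk_one]

lemma hsSq_blk : hsSq (blk N X) = 2 * hsSq X := by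
  simp only [hsSq, ← Equiv.sum_comp (halves N), blk_apply, Fintype.sum_sum_type]
  simp
  ring

lemma hs_blk : hs (blk N X) = hs X := by
  have h : (0 : ℝ) < ((N.1 / 2 : ℕ) : ℝ) := by exact_mod_cast N.half_pos
  rw [hs, hs, hsSq_blk, Fintype.card_fin, Fintype.card_fin, N.cast_eq,
    mul_div_mul_left _ _ two_ne_zero]

/-- The function e(2mq) has period 1/2 for integral m, so it repeats identically on the two halves.
-/
lemma blk_clock (N : EvenPos) (m : ℤ) : blk N (clock (N.1 / 2) m) = clock N.1 (2 * m) := by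
  have h : (0 : ℝ) < ((N.1 / 2 : ℕ) : ℝ) := by exact_mod_cast N.half_pos
  rw [blk, clock, clock, Matrix.fromBlocks_diagonal, Matrix.reindex_apply,
    Matrix.submatrix_diagonal_equiv]
  congr 1
  funext n
  obtain ⟨s, rfl⟩ := (halves N).surjective n
  rw [Function.comp_apply, Equiv.symm_apply_apply]
  rcases s with s | s
  · rw [Sum.elim_inl, halves_inl, N.cast_eq]
    congr 1
    field_simp
  · rw [Sum.elim_inr, halves_inr, N.cast_eq]
    refine e_eq_e_of_int (-m) ?_
    push_cast
    field_simp
    ring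

/-- The clock matrix is, up to block scalars, the block matrix of the half-size clock matrix of
half the frequency. -/
lemma clock_mul_blk_clock_comm (κ : ℝ) :
    clock N.1 κ * blk N (clock (N.1 / 2) (-(κ / 2))) * blk N X =
      blk N X * (clock N.1 κ * blk N (clock (N.1 / 2) (-(κ / 2)))) := by
  have h : (0 : ℝ) < ((N.1 / 2 : ℕ) : ℝ) := by exact_mod_cast N.half_pos
  -- The phases cancel on the lower half and leave the constant e(κ/2) on the upper half. The
  -- product is scalar on each half, hence commutes with every block-diagonal matrix.
  have hd : clock N.1 κ * blk N (clock (N.1 / 2) (-(κ / 2))) =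
      (Matrix.diagonal (Sum.elim (fun _ : Fin (N.1 / 2) => (1 : ℂ)) fun _ : Fin (N.1 / 2) =>
        e (κ / 2))).reindex (halves N) (halves N) := by
    rw [blk, clock, clock, Matrix.fromBlocks_diagonal, Matrix.reindex_apply, Matrix.reindex_apply,
      Matrix.submatrix_diagonal_equiv, Matrix.submatrix_diagonal_equiv,
      Matrix.diagonal_mul_diagonal]
    congr 1
    funext n
    obtain ⟨s, rfl⟩ := (halves N).surjective n
    simp only [Function.comp_apply, Equiv.symm_apply_apply]
    rcases s with s | s
    · rw [Sum.elim_inl, Sum.elim_inl, halves_inl, N.cast_eq, ← e_add]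
      rw [← e_zero]
      congr 1
      field_simp
      ring
    · rw [Sum.elim_inr, Sum.elim_inr, halves_inr, N.cast_eq, ← e_add]
      congr 1
      push_cast
      field_simp
      ring
  rw [hd]
  apply matrix_ext_halves
  simp only [Matrix.reindex_apply, Matrix.submatrix_diagonal_equiv, Matrix.diagonal_mul,
    Matrix.mul_diagonal, blk_apply]
  rintro (s | s) (t | t) <;> simp [mul_comm]

/-! ### Comparison of the shifts of half and full size -/

lemma modEq_iff_eq_of_lt {M : ℕ} {i z : ℤ} (hi : 0 ≤ i) (hi' : i < M) (hz : 0 ≤ z) (hz' : z < M) :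
    i ≡ z [ZMOD (M : ℤ)] ↔ i = z := by
  rw [Int.ModEq, Int.emod_eq_of_lt hi hi', Int.emod_eq_of_lt hz hz']

lemma sum_norm_sq_col {ι : Type*} [Fintype ι] [DecidableEq ι] {U : Matrix ι ι ℂ}
    (hU : U ∈ Matrix.unitaryGroup ι ℂ) (j : ι) : ∑ i, ‖U i j‖ ^ 2 = 1 := by
  have h := congr_fun (congr_fun (conjTranspose_mul_self_of_unitary hU) j) j
  rw [Matrix.mul_apply, Matrix.one_apply_eq] at h
  apply Complex.ofReal_injective
  push_cast
  rw [← h]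
  refine Finset.sum_congr rfl fun i _ => ?_
  rw [Matrix.conjTranspose_apply, ← starRingEnd_apply, mul_comm, Complex.mul_conj']

lemma card_shift_out (M : ℕ) (m : ℤ) :
    (Finset.univ.filter fun j : Fin M => ¬ (0 ≤ ((j : ℕ) : ℤ) + m ∧ ((j : ℕ) : ℤ) + m < M)).card ≤
      m.natAbs := by
  rw [← Finset.card_range m.natAbs]
  -- For `m ≥ 0` the indices leaving the window are the last ones, counted from the end; for `m < 0`
  -- they are the first ones.
  refine Finset.card_le_card_of_injOn (fun j => if 0 ≤ m then M - 1 - (j : ℕ) else (j : ℕ)) ?_ ?_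
  · intro j hj
    have hj' : ¬ (0 ≤ ((j : ℕ) : ℤ) + m ∧ ((j : ℕ) : ℤ) + m < M) := by simpa using hj
    have := j.2
    simp only [Finset.coe_range, Set.mem_Iio]
    split_ifs <;> omega
  · intro i _ j _ hij
    have := i.2
    have := j.2
    ext
    simp only at hij
    split_ifs at hij <;> omega

lemma shift_apply_of_mem {M : ℕ} {m : ℤ} (i : Fin M) {j : Fin M}
    (hj : 0 ≤ ((j : ℕ) : ℤ) + m ∧ ((j : ℕ) : ℤ) + m < M) :
    shift M m i j = if ((i : ℕ) : ℤ) = ((j : ℕ) : ℤ) + m then 1 else 0 := by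
  rw [shift, Matrix.of_apply]
  simp only [modEq_iff_eq_of_lt (Int.natCast_nonneg i) (Int.ofNat_lt.2 i.2) hj.1 hj.2]

/-- The two shifts have the same column wherever the half-size shift does not wrap around. At most
2|m| columns remain, |m| in each half. Each contributes at most 4 to the squared norm, being a
difference of two unit vectors. -/
lemma hs_blk_shift_sub_le (N : EvenPos) (m : ℤ) :
    hs (blk N (shift (N.1 / 2) m) - shift N.1 m) ≤ Real.sqrt (8 * |(m : ℝ)| / N.1) := by
  rw [hs, Fintype.card_fin]
  apply Real.sqrt_le_sqrt
  gcongr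
  have hN := N.two_mul_half
  classical
  obtain ⟨P, hP⟩ : ∃ P : Fin (N.1 / 2) → Prop, P = fun j : Fin (N.1 / 2) =>
    ¬ (0 ≤ ((j : ℕ) : ℤ) + m ∧ ((j : ℕ) : ℤ) + m < ((N.1 / 2 : ℕ) : ℤ)) := ⟨_, rfl⟩
  have hcard : (Finset.univ.filter P).card ≤ m.natAbs := by
    subst hP
    convert card_shift_out (N.1 / 2) m
  have hcol : ∀ j : Fin N.1, ∑ i, ‖(blk N (shift (N.1 / 2) m) - shift N.1 m) i j‖ ^ 2 ≤ 4 := by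
    intro j
    have h1 := sum_norm_sq_col (blk_unitary (N := N) (shift_unitary (N.1 / 2) m)) j
    have h2 := sum_norm_sq_col (shift_unitary N.1 m) j
    calc ∑ i, ‖(blk N (shift (N.1 / 2) m) - shift N.1 m) i j‖ ^ 2
        ≤ ∑ i, (2 * ‖blk N (shift (N.1 / 2) m) i j‖ ^ 2 + 2 * ‖shift N.1 m i j‖ ^ 2) := by
          gcongr with i
          rw [Matrix.sub_apply]
          have := norm_sub_le (blk N (shift (N.1 / 2) m) i j) (shift N.1 m i j)
          have h0 := norm_nonneg (blk N (shift (N.1 / 2) m) i j - shift N.1 m i j)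
          nlinarith [sq_nonneg (‖blk N (shift (N.1 / 2) m) i j‖ - ‖shift N.1 m i j‖)]
      _ = 4 := by
          rw [Finset.sum_add_distrib, ← Finset.mul_sum, ← Finset.mul_sum, h1, h2]; norm_num
  have hgood : ∀ (b : Fin (N.1 / 2) ⊕ Fin (N.1 / 2)), ¬ P (b.elim id id) →
      ∑ i, ‖(blk N (shift (N.1 / 2) m) - shift N.1 m) i (halves N b)‖ ^ 2 = 0 := by
    intro b hb
    simp only [hP, not_not] at hb
    apply Finset.sum_eq_zero
    intro i _
    obtain ⟨a, rfl⟩ := (halves N).surjective i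
    rw [Matrix.sub_apply, blk_apply, sq_eq_zero_iff, norm_eq_zero, sub_eq_zero]
    have hz : 0 ≤ ((halves N b : ℕ) : ℤ) + m ∧ ((halves N b : ℕ) : ℤ) + m < N.1 := by
      rcases b with b | b <;> simp only [Sum.elim_inl, Sum.elim_inr, id] at hb <;>
        simp only [halves_inl, halves_inr] <;> omega
    rw [shift_apply_of_mem _ hz]
    rcases a with a | a <;> rcases b with b | b <;>
      simp only [Sum.elim_inl, Sum.elim_inr, id] at hb <;>
      simp only [Matrix.fromBlocks_apply₁₁, Matrix.fromBlocks_apply₁₂, Matrix.fromBlocks_apply₂₁,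
        Matrix.fromBlocks_apply₂₂, Matrix.zero_apply, shift_apply_of_mem _ hb, halves_inl,
        halves_inr]
    · rw [if_neg]
      omega
    · rw [if_neg]
      omega
    · push_cast
      simp only [add_assoc, add_right_inj]
  unfold hsSq
  rw [Finset.sum_comm, ← Equiv.sum_comp (halves N)]
  calc ∑ b, ∑ i, ‖(blk N (shift (N.1 / 2) m) - shift N.1 m) i (halves N b)‖ ^ 2
      ≤ ∑ b : Fin (N.1 / 2) ⊕ Fin (N.1 / 2),
          Sum.elim (fun j => if P j then (4 : ℝ) else 0) (fun j => if P j then (4 : ℝ) else 0) b := by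
        gcongr with b
        have h : (if P (b.elim id id) then (4 : ℝ) else 0) = Sum.elim
            (fun j => if P j then (4 : ℝ) else 0) (fun j => if P j then (4 : ℝ) else 0) b := by
          rcases b with b | b <;> rfl
        rw [← h]
        split_ifs with hb
        · exact hcol _
        · exact (hgood b hb).le
    _ = 8 * ((Finset.univ.filter P).card : ℝ) := by
        rw [Fintype.sum_sum_type]
        simp only [Sum.elim_inl, Sum.elim_inr, ← Finset.sum_filter, Finset.sum_const,
          nsmul_eq_mul]
        ring
    _ ≤ 8 * |(m : ℝ)| := by
        have : ((Finset.univ.filter P).card : ℝ) ≤ (m.natAbs : ℝ) := by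
          exact_mod_cast hcard
        rw [Nat.cast_natAbs, Int.cast_abs] at this
        linarith

/-! ### Heisenberg evolution under the baker's map -/

lemma bakerOp_eq (N : EvenPos) :
    bakerOp N = (dft N.1).conjTranspose * blk N (dft (N.1 / 2)) := by
  rw [bakerOp, Matrix.inv_eq_left_inv (conjTranspose_mul_self_of_unitary (dft_unitary N.1))]
  rfl

lemma bakerOp_unitary (N : EvenPos) : bakerOp N ∈ Matrix.unitaryGroup (Fin N.1) ℂ := by
  rw [bakerOp_eq]
  exact mul_mem (unitaryGroup_conjTranspose (dft_unitary N.1)) (blk_unitary (dft_unitary _))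

/-- The Heisenberg evolution of an operator under the quantised baker's map. -/
def heis (N : EvenPos) (A : Matrix (Fin N.1) (Fin N.1) ℂ) : Matrix (Fin N.1) (Fin N.1) ℂ :=
  (bakerOp N).conjTranspose * A * bakerOp N

/-- The diagonal operator in the momentum basis with symbol `e (κ p)`, `p ∈ [0, 1)`. -/
def momClock (M : ℕ) (κ : ℝ) : Matrix (Fin M) (Fin M) ℂ :=
  (dft M).conjTranspose * clock M κ * dft M

lemma heis_mul (A B : Matrix (Fin N.1) (Fin N.1) ℂ) :
    heis N (A * B) = heis N A * heis N B := by
  simp only [heis, Matrix.mul_assoc]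
  rw [← Matrix.mul_assoc (bakerOp N) (bakerOp N).conjTranspose,
    mul_conjTranspose_self_of_unitary (bakerOp_unitary N), Matrix.one_mul]

lemma heis_add (A B : Matrix (Fin N.1) (Fin N.1) ℂ) :
    heis N (A + B) = heis N A + heis N B := by
  simp only [heis, Matrix.mul_add, Matrix.add_mul]

lemma heis_sub (A B : Matrix (Fin N.1) (Fin N.1) ℂ) :
    heis N (A - B) = heis N A - heis N B := by
  simp only [heis, Matrix.mul_sub, Matrix.sub_mul]

lemma heis_smul (c : ℂ) (A : Matrix (Fin N.1) (Fin N.1) ℂ) :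
    heis N (c • A) = c • heis N A := by
  simp only [heis, Matrix.mul_smul, Matrix.smul_mul]

lemma hs_heis (A : Matrix (Fin N.1) (Fin N.1) ℂ) : hs (heis N A) = hs A := by
  rw [heis, hs_mul_unitary (bakerOp_unitary N),
    hs_unitary_mul (unitaryGroup_conjTranspose (bakerOp_unitary N))]

lemma heis_unitary {A : Matrix (Fin N.1) (Fin N.1) ℂ} (hA : A ∈ Matrix.unitaryGroup _ ℂ) :
    heis N A ∈ Matrix.unitaryGroup _ ℂ :=
  mul_mem (mul_mem (unitaryGroup_conjTranspose (bakerOp_unitary N)) hA) (bakerOp_unitary N)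

lemma heis_eq (A : Matrix (Fin N.1) (Fin N.1) ℂ) :
    heis N A = (blk N (dft (N.1 / 2))).conjTranspose *
      (dft N.1 * A * (dft N.1).conjTranspose) * blk N (dft (N.1 / 2)) := by
  rw [heis, bakerOp_eq, Matrix.conjTranspose_mul, Matrix.conjTranspose_conjTranspose]
  simp only [Matrix.mul_assoc]

/-- Egorov property for q ↦ 2q. The full Fourier transform turns the clock into the full shift,
while the block Fourier transform turns the clock of doubled frequency into the block shift; the
error is a unitary conjugate of the difference of the two shifts. -/
lemma hs_heis_clock_sub_le (N : EvenPos) (m : ℤ) :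
    hs (heis N (clock N.1 m) - clock N.1 (2 * m)) ≤ Real.sqrt (8 * |(m : ℝ)| / N.1) := by
  refine le_of_eq_of_le ?_ (hs_blk_shift_sub_le N m)
  have hu := blk_unitary (N := N) (dft_unitary (N.1 / 2))
  have h2 : clock N.1 (2 * m) = (blk N (dft (N.1 / 2))).conjTranspose *
      blk N (shift (N.1 / 2) m) * blk N (dft (N.1 / 2)) := by
    rw [← blk_clock, ← blk_conjTranspose, ← blk_mul, ← blk_mul, Matrix.mul_assoc,
      ← dft_mul_clock, ← Matrix.mul_assoc, conjTranspose_mul_self_of_unitary (dft_unitary _),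
      Matrix.one_mul]
  rw [heis_eq, ← shift_eq_conj_clock, h2, ← Matrix.sub_mul, ← Matrix.mul_sub,
    hs_mul_unitary hu, hs_unitary_mul (unitaryGroup_conjTranspose hu), hs_sub_comm]

/-- Exact for all real κ. The first two factors together are the quantum form of e(κ[2q]/2),
constant on each half; the remaining block clock is conjugated into the momentum operator of half
the frequency within each block. -/
lemma heis_momClock (N : EvenPos) (κ : ℝ) :
    heis N (momClock N.1 κ) =
      clock N.1 κ * blk N (clock (N.1 / 2) (-(κ / 2))) *
        blk N (momClock (N.1 / 2) (κ / 2)) := by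
  have h1 : dft N.1 * momClock N.1 κ * (dft N.1).conjTranspose = clock N.1 κ := by
    have := mul_conjTranspose_self_of_unitary (dft_unitary N.1)
    rw [momClock, ← Matrix.mul_assoc, ← Matrix.mul_assoc, this, Matrix.one_mul, Matrix.mul_assoc,
      this, Matrix.mul_one]
  have h2 : clock N.1 κ = clock N.1 κ * blk N (clock (N.1 / 2) (-(κ / 2))) *
      blk N (clock (N.1 / 2) (κ / 2)) := by
    rw [Matrix.mul_assoc, ← blk_mul, ← clock_add]
    simp [blk_one]
  rw [heis_eq, h1, h2, ← blk_conjTranspose, ← Matrix.mul_assoc, ← clock_mul_blk_clock_comm,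
    momClock, blk_mul, blk_mul, ← h2]
  simp only [Matrix.mul_assoc]

end Baker

/-! ### Approximation by trigonometric polynomials -/

lemma card_filter_lt_le (M : ℕ) {b : ℝ} (hb : 0 ≤ b) :
    (((Finset.univ.filter fun n : Fin M => ((n : ℕ) : ℝ) < b).card : ℕ) : ℝ) ≤ b + 1 := by
  have h : (Finset.univ.filter fun n : Fin M => ((n : ℕ) : ℝ) < b).card ≤ ⌈b⌉₊ := by
    rw [← Finset.card_range ⌈b⌉₊]
    refine Finset.card_le_card_of_injOn (fun n => (n : ℕ)) ?_ ?_
    · intro n hn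
      have hn' : ((n : ℕ) : ℝ) < b := by simpa using hn
      simpa using Nat.lt_ceil.2 hn'
    · intro i _ j _ hij
      exact Fin.ext hij
  exact (Nat.cast_le.2 h).trans (Nat.ceil_lt_add_one hb).le

lemma card_filter_near_end_le (M : ℕ) {b : ℝ} (hb : 0 ≤ b) :
    (((Finset.univ.filter fun n : Fin M => (M : ℝ) - ((n : ℕ) : ℝ) < b).card : ℕ) : ℝ) ≤
      b + 1 := by
  refine le_trans (Nat.cast_le.2 ?_) (card_filter_lt_le M hb)
  refine Finset.card_le_card_of_injOn Fin.rev ?_ (Fin.rev_injective.injOn)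
  intro n hn
  have hn' : (M : ℝ) - ((n : ℕ) : ℝ) < b := by simpa using hn
  simp only [Finset.coe_filter, Finset.mem_univ, true_and, Set.mem_ofPred_eq]
  refine lt_of_le_of_lt ?_ hn'
  rw [Fin.val_rev, Nat.cast_sub (by omega)]
  push_cast
  linarith

/-- A tent-shaped cutoff on `[0, 1]` vanishing at the end points. -/
def tent (δ x : ℝ) : ℝ := max 0 (min 1 (min (x / δ) ((1 - x) / δ)))

lemma continuous_tent (δ : ℝ) : Continuous (tent δ) := by
  unfold tent; fun_prop

lemma tent_nonneg (δ x : ℝ) : 0 ≤ tent δ x := le_max_left _ _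

lemma tent_le_one (δ x : ℝ) : tent δ x ≤ 1 := max_le zero_le_one (min_le_left _ _)

lemma tent_eq_one {δ x : ℝ} (hδ : 0 < δ) (h0 : δ ≤ x) (h1 : δ ≤ 1 - x) : tent δ x = 1 := by
  rw [tent, min_eq_left, max_eq_right zero_le_one]
  exact le_min ((one_le_div hδ).2 h0) ((one_le_div hδ).2 h1)

lemma tent_zero (δ : ℝ) : tent δ 0 = 0 := by
  rw [tent, max_eq_left]
  exact (min_le_right _ _).trans ((min_le_left _ _).trans (by simp))

lemma tent_one (δ : ℝ) : tent δ 1 = 0 := by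
  rw [tent, max_eq_left]
  exact (min_le_right _ _).trans ((min_le_right _ _).trans (by simp))

/-- Only the entries within δ of an end point change, each by at most 1, and there are at most δM +
1 of them at either end. -/
lemma hs_clock_sub_cutoff_le {M : ℕ} (hM : 0 < M) (κ : ℝ) {δ : ℝ} (hδ : 0 < δ) :
    hs (clock M κ - Matrix.diagonal fun n : Fin M =>
      e (κ * ((n : ℕ) / M : ℝ)) * (tent δ ((n : ℕ) / M : ℝ) : ℂ)) ≤
      Real.sqrt (2 * δ + 2 / M) := by
  have hM' : (0 : ℝ) < M := by positivity
  rw [clock, Matrix.diagonal_sub, hs_diagonal]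
  apply Real.sqrt_le_sqrt
  rw [Fintype.card_fin, div_le_iff₀ hM']
  have hterm : ∀ n : Fin M, ‖e (κ * (n : ℕ) / M) -
      e (κ * ((n : ℕ) / M : ℝ)) * (tent δ ((n : ℕ) / M : ℝ) : ℂ)‖ ^ 2 ≤
      (if ((n : ℕ) : ℝ) < δ * M then (1 : ℝ) else 0) +
        (if (M : ℝ) - ((n : ℕ) : ℝ) < δ * M then (1 : ℝ) else 0) := by
    intro n
    set t := tent δ ((n : ℕ) / M : ℝ) with ht
    have h1 : ‖e (κ * (n : ℕ) / M) - e (κ * ((n : ℕ) / M : ℝ)) * (t : ℂ)‖ = 1 - t := by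
      rw [mul_div_assoc, ← mul_one_sub, norm_mul, norm_e, one_mul,
        show (1 - t : ℂ) = ((1 - t : ℝ) : ℂ) by push_cast; ring, Complex.norm_real,
        Real.norm_of_nonneg (by have := tent_le_one δ ((n : ℕ) / M : ℝ); linarith)]
    have h2 : (1 - t) ^ 2 ≤ 1 := by
      have := tent_nonneg δ ((n : ℕ) / M : ℝ)
      have := tent_le_one δ ((n : ℕ) / M : ℝ)
      nlinarith
    rw [h1]
    split_ifs with ha hb hb
    · linarith
    · linarith
    · linarith
    · have : t = 1 := by
        apply tent_eq_one hδ
        · rw [le_div_iff₀ hM']; linarith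
        · rw [one_sub_div hM'.ne', le_div_iff₀ hM']; linarith
      rw [this]; norm_num
  calc _ ≤ ∑ n : Fin M, ((if ((n : ℕ) : ℝ) < δ * M then (1 : ℝ) else 0) +
        (if (M : ℝ) - ((n : ℕ) : ℝ) < δ * M then (1 : ℝ) else 0)) :=
      Finset.sum_le_sum fun n _ => hterm n
    _ ≤ (δ * M + 1) + (δ * M + 1) := by
      rw [Finset.sum_add_distrib, Finset.sum_boole, Finset.sum_boole]
      gcongr
      · exact card_filter_lt_le M (by positivity)
      · exact card_filter_near_end_le M (by positivity)
    _ = (2 * δ + 2 / M) * M := by field_simp; ring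

/-- A continuous function on `[0, 1]` with equal values at the end points is a uniform limit of
trigonometric polynomials. -/
lemma exists_trigPoly_near {c : ℝ → ℂ} (hc : Continuous c) (h01 : c 0 = c 1) {ε : ℝ}
    (hε : 0 < ε) :
    ∃ (s : Finset ℤ) (g : ℤ → ℂ), ∀ x ∈ Set.Ico (0 : ℝ) 1,
      ‖c x - ∑ m ∈ s, g m * e (m * x)‖ ≤ ε := by
  have : Fact ((0 : ℝ) < 1) := ⟨one_pos⟩
  let F : C(AddCircle (1 : ℝ), ℂ) :=
    ⟨AddCircle.liftIco 1 0 c, AddCircle.liftIco_zero_continuous h01 hc.continuousOn⟩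
  have hF : F ∈ (Submodule.span ℂ (Set.range <| @fourier 1)).topologicalClosure := by
    rw [span_fourier_closure_eq_top]; trivial
  rw [← SetLike.mem_coe, Submodule.topologicalClosure_coe, Metric.mem_closure_iff] at hF
  obtain ⟨p, hp, hFp⟩ := hF ε hε
  rw [SetLike.mem_coe, Finsupp.mem_span_range_iff_exists_finsupp] at hp
  obtain ⟨g, rfl⟩ := hp
  refine ⟨g.support, g, fun x hx => ?_⟩
  have h1 : F (x : AddCircle (1 : ℝ)) = c x :=
    AddCircle.liftIco_zero_coe_apply hx
  have h2 : (g.sum fun m a => a • @fourier 1 m) (x : AddCircle (1 : ℝ)) =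
      ∑ m ∈ g.support, g m * e (m * x) := by
    rw [Finsupp.sum, ContinuousMap.sum_apply]
    refine Finset.sum_congr rfl fun m _ => ?_
    rw [ContinuousMap.smul_apply, fourier_coe_apply, smul_eq_mul, e]
    congr 2
    push_cast
    ring
  rw [← h1, ← h2, ← ContinuousMap.sub_apply]
  exact (ContinuousMap.norm_coe_le_norm _ _).trans (by rw [← dist_eq_norm]; exact hFp.le)

/-- For non-integral κ the function e(κx) jumps on the circle, so no uniform trigonometric
approximation exists. Cutting off near the jump costs little in the Hilbert–Schmidt norm, and the
result is continuous on the circle. The same coefficients serve all large `M`. -/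
lemma exists_clock_sum_near (κ : ℝ) {ε : ℝ} (hε : 0 < ε) :
    ∃ (s : Finset ℤ) (g : ℤ → ℂ) (M₀ : ℕ), ∀ M ≥ M₀,
      hs (clock M κ - ∑ m ∈ s, g m • clock M m) ≤ ε := by
  -- With M ≥ 16/ε² both 2δ and 2/M are at most ε²/8, so the cutoff error is at most ε/2.
  set δ := ε ^ 2 / 16 with hδ_def
  have hδ : 0 < δ := by positivity
  set c : ℝ → ℂ := fun x => e (κ * x) * (tent δ x : ℂ) with hc_def
  have hc : Continuous c :=
    (continuous_e.comp (continuous_const.mul continuous_id)).mul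
      (Complex.continuous_ofReal.comp (continuous_tent δ))
  have h01 : c 0 = c 1 := by
    simp [hc_def, tent_zero, tent_one]
  obtain ⟨s, g, hg⟩ := exists_trigPoly_near hc h01 (half_pos hε)
  refine ⟨s, g, ⌈16 / ε ^ 2⌉₊ + 1, fun M hM => ?_⟩
  have hM0 : 0 < M := by omega
  have hM' : (0 : ℝ) < M := by positivity
  have hM1 : 16 / ε ^ 2 ≤ M :=
    (Nat.le_ceil _).trans (by exact_mod_cast (by omega : ⌈16 / ε ^ 2⌉₊ ≤ M))
  have h1 : hs (clock M κ - Matrix.diagonal fun n : Fin M => c ((n : ℕ) / M : ℝ)) ≤ ε / 2 := by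
    refine (hs_clock_sub_cutoff_le hM0 κ hδ).trans ?_
    apply Real.sqrt_le_iff.2 ⟨by positivity, ?_⟩
    have : 2 / (M : ℝ) ≤ ε ^ 2 / 8 := by
      rw [div_le_iff₀ (by positivity)] at hM1
      rw [div_le_iff₀ hM']
      linarith
    rw [hδ_def]
    linarith
  have h2 : hs ((Matrix.diagonal fun n : Fin M => c ((n : ℕ) / M : ℝ)) -
      ∑ m ∈ s, g m • clock M m) ≤ ε / 2 := by
    have : (∑ m ∈ s, g m • clock M m) = Matrix.diagonal fun n : Fin M =>
        ∑ m ∈ s, g m * e (m * ((n : ℕ) / M : ℝ)) := by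
      ext i j
      rw [Matrix.sum_apply]
      by_cases hij : i = j
      · subst hij
        simp [clock, mul_div_assoc]
      · simp [clock, hij]
    rw [this, Matrix.diagonal_sub]
    apply hs_diagonal_le (by positivity)
    intro n
    apply hg
    constructor
    · positivity
    · rw [div_lt_one hM']; exact_mod_cast n.2
  calc _ ≤ _ := hs_sub_le _ (Matrix.diagonal fun n : Fin M => c ((n : ℕ) / M : ℝ)) _
    _ ≤ ε := by linarith

/-! ### Sequences of operators -/

lemma tendsto_evenPos : Tendsto (fun N : EvenPos => N.1) atTop atTop := by
  refine tendsto_atTop.2 fun b => ?_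
  filter_upwards [eventually_ge_atTop (⟨2 * (b + 1), by omega, even_two_mul _⟩ : EvenPos)] with N hN
  have : 2 * (b + 1) ≤ N.1 := hN
  omega

lemma tendsto_evenPos_half : Tendsto (fun N : EvenPos => N.1 / 2) atTop atTop :=
  (Nat.tendsto_div_const_atTop two_ne_zero).comp tendsto_evenPos

lemma tendsto_sqrt_div_evenPos (C : ℝ) :
    Tendsto (fun N : EvenPos => Real.sqrt (C / N.1)) atTop (𝓝 0) := by
  have h : Tendsto (fun N : EvenPos => C / (N.1 : ℝ)) atTop (𝓝 0) :=
    tendsto_const_nhds.div_atTop (tendsto_natCast_atTop_atTop.comp tendsto_evenPos)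
  have h' := (Real.continuous_sqrt.tendsto 0).comp h
  rw [Real.sqrt_zero] at h'
  exact h'

/-- A sequence of operators, one for each admissible `N`. -/
abbrev OpSeq : Type := ∀ N : EvenPos, Matrix (Fin N.1) (Fin N.1) ℂ

/-- Asymptotic equality in the normalised Hilbert–Schmidt norm. -/
def AsympEq (A A' : OpSeq) : Prop := Tendsto (fun N => hs (A N - A' N)) atTop (𝓝 0)

lemma AsympEq.refl (A : OpSeq) : AsympEq A A := by
  simpa [AsympEq] using tendsto_const_nhds

lemma AsympEq.of_le {A A' : OpSeq} {u : EvenPos → ℝ} (hu : Tendsto u atTop (𝓝 0))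
    (h : ∀ N, hs (A N - A' N) ≤ u N) : AsympEq A A' :=
  squeeze_zero (fun _ => hs_nonneg _) h hu

lemma AsympEq.trans {A A' A'' : OpSeq} (h : AsympEq A A') (h' : AsympEq A' A'') :
    AsympEq A A'' :=
  AsympEq.of_le (by simpa using Tendsto.add h h') fun _ => hs_sub_le _ _ _

lemma AsympEq.of_eventually_le {A A' : OpSeq}
    (h : ∀ ε > 0, ∀ᶠ N in atTop, hs (A N - A' N) ≤ ε) : AsympEq A A' := by
  refine Metric.tendsto_nhds.2 fun ε hε => ?_
  filter_upwards [h (ε / 2) (by positivity)] with N hN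
  rw [Real.dist_0_eq_abs, abs_of_nonneg (hs_nonneg _)]
  linarith

lemma AsympEq.eventually_le {A A' : OpSeq} (h : AsympEq A A') {ε : ℝ} (hε : 0 < ε) :
    ∀ᶠ N in atTop, hs (A N - A' N) ≤ ε :=
  (h.eventually_lt_const hε).mono fun _ => le_of_lt

/-- A sequence of unitary operators. -/
def IsUnitarySeq (A : OpSeq) : Prop := ∀ N, A N ∈ Matrix.unitaryGroup (Fin N.1) ℂ

lemma IsUnitarySeq.mul {A B : OpSeq} (hA : IsUnitarySeq A) (hB : IsUnitarySeq B) :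
    IsUnitarySeq (A * B) := fun N => mul_mem (hA N) (hB N)

lemma AsympEq.mul_left {A B C : OpSeq} (hA : IsUnitarySeq A) (h : AsympEq B C) :
    AsympEq (A * B) (A * C) := by
  refine AsympEq.of_le h fun N => ?_
  rw [Pi.mul_apply, Pi.mul_apply, ← Matrix.mul_sub, hs_unitary_mul (hA N)]

/-- The sequences which are approximated by elements of `S`, asymptotically in the normalised
Hilbert–Schmidt norm. -/
def asympClosure (S : Submodule ℂ OpSeq) : Submodule ℂ OpSeq where
  carrier := {A | ∀ ε > 0, ∃ A' ∈ S, ∀ᶠ N in atTop, hs (A N - A' N) ≤ ε}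
  zero_mem' := fun ε hε => ⟨0, S.zero_mem, Eventually.of_forall fun N => by simp [hε.le]⟩
  add_mem' := by
    intro A B hA hB ε hε
    obtain ⟨A', hA', h1⟩ := hA (ε / 2) (by positivity)
    obtain ⟨B', hB', h2⟩ := hB (ε / 2) (by positivity)
    refine ⟨A' + B', S.add_mem hA' hB', ?_⟩
    filter_upwards [h1, h2] with N h1 h2
    rw [Pi.add_apply, Pi.add_apply, add_sub_add_comm]
    exact (hs_add_le _ _).trans (by linarith)
  smul_mem' := by
    intro c A hA ε hε
    obtain ⟨A', hA', h1⟩ := hA (ε / (‖c‖ + 1)) (by positivity)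
    refine ⟨c • A', S.smul_mem c hA', ?_⟩
    filter_upwards [h1] with N h1
    rw [Pi.smul_apply, Pi.smul_apply, ← smul_sub, hs_smul]
    rw [le_div_iff₀ (by positivity)] at h1
    nlinarith [hs_nonneg (A N - A' N)]

lemma mem_asympClosure {S : Submodule ℂ OpSeq} {A : OpSeq} :
    A ∈ asympClosure S ↔ ∀ ε > 0, ∃ A' ∈ S, ∀ᶠ N in atTop, hs (A N - A' N) ≤ ε := Iff.rfl

lemma le_asympClosure (S : Submodule ℂ OpSeq) : S ≤ asympClosure S := fun A hA _ hε =>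
  ⟨A, hA, Eventually.of_forall fun N => by simp [hε.le]⟩

lemma asympClosure_mono {S T : Submodule ℂ OpSeq} (h : S ≤ T) :
    asympClosure S ≤ asympClosure T := fun _ hA ε hε =>
  let ⟨A', hA', h'⟩ := hA ε hε
  ⟨A', h hA', h'⟩

lemma asympClosure_idem (S : Submodule ℂ OpSeq) :
    asympClosure (asympClosure S) ≤ asympClosure S := by
  intro A hA ε hε
  obtain ⟨B, hB, h1⟩ := hA (ε / 2) (by positivity)
  obtain ⟨C, hC, h2⟩ := hB (ε / 2) (by positivity)
  refine ⟨C, hC, ?_⟩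
  filter_upwards [h1, h2] with N h1 h2
  exact (hs_sub_le _ (B N) _).trans (by linarith)

lemma AsympEq.mem_asympClosure {S : Submodule ℂ OpSeq} {A A' : OpSeq} (h : AsympEq A A')
    (hA' : A' ∈ asympClosure S) : A ∈ asympClosure S :=
  asympClosure_idem S fun _ hε => ⟨A', hA', h.eventually_le hε⟩

lemma map_mem_asympClosure {S : Submodule ℂ OpSeq} (L : OpSeq →ₗ[ℂ] OpSeq)
    (hL : ∀ A N, hs (L A N) ≤ hs (A N)) (hS : ∀ A ∈ S, L A ∈ asympClosure S) {A : OpSeq}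
    (hA : A ∈ asympClosure S) : L A ∈ asympClosure S := by
  refine asympClosure_idem S fun ε hε => ?_
  obtain ⟨B, hB, h⟩ := hA ε hε
  refine ⟨L B, hS B hB, ?_⟩
  filter_upwards [h] with N h
  have h1 := hL (A - B) N
  rw [map_sub] at h1
  exact h1.trans h

/-- The Heisenberg evolution of sequences. -/
def heisSeq : OpSeq →ₗ[ℂ] OpSeq where
  toFun A := fun N => heis N (A N)
  map_add' A B := funext fun N => heis_add (A N) (B N)
  map_smul' c A := funext fun N => heis_smul c (A N)

lemma heisSeq_apply (A : OpSeq) (N : EvenPos) : heisSeq A N = heis N (A N) := rfl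

lemma heisSeq_mul (A B : OpSeq) : heisSeq (A * B) = heisSeq A * heisSeq B :=
  funext fun N => heis_mul (A N) (B N)

lemma IsUnitarySeq.heisSeq {A : OpSeq} (hA : IsUnitarySeq A) : IsUnitarySeq (heisSeq A) :=
  fun N => heis_unitary (hA N)

lemma AsympEq.heisSeq {A B : OpSeq} (h : AsympEq A B) : AsympEq (heisSeq A) (heisSeq B) := by
  refine AsympEq.of_le h fun N => ?_
  rw [heisSeq_apply, heisSeq_apply, ← heis_sub, hs_heis]

/-! ### Position observables -/

/-- The sequence of clock matrices. -/
def clockSeq (κ : ℝ) : OpSeq := fun N => clock N.1 κ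

/-- The sequence of block clock matrices. -/
def blkClockSeq (κ : ℝ) : OpSeq := fun N => blk N (clock (N.1 / 2) κ)

/-- The span of the clock matrices of integral frequency. -/
def trigSpan : Submodule ℂ OpSeq := Submodule.span ℂ (Set.range fun m : ℤ => clockSeq m)

/-- The asymptotic position observables. -/
def posObs : Submodule ℂ OpSeq := asympClosure trigSpan

lemma isUnitarySeq_clockSeq (κ : ℝ) : IsUnitarySeq (clockSeq κ) := fun N => clock_unitary N.1 κ

lemma isUnitarySeq_blkClockSeq (κ : ℝ) : IsUnitarySeq (blkClockSeq κ) :=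
  fun N => blk_unitary (clock_unitary (N.1 / 2) κ)

lemma clockSeq_int_mem_trigSpan (m : ℤ) : clockSeq m ∈ trigSpan :=
  Submodule.subset_span ⟨m, rfl⟩

lemma clockSeq_int_mem_posObs (m : ℤ) : clockSeq m ∈ posObs :=
  le_asympClosure _ (clockSeq_int_mem_trigSpan m)

lemma one_mem_posObs : (1 : OpSeq) ∈ posObs := by
  have h : clockSeq (0 : ℤ) = 1 := by funext N; simp [clockSeq]
  rw [← h]
  exact clockSeq_int_mem_posObs 0

lemma clockSeq_mem_posObs (κ : ℝ) : clockSeq κ ∈ posObs := by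
  intro ε hε
  obtain ⟨s, g, M₀, h⟩ := exists_clock_sum_near κ hε
  refine ⟨∑ m ∈ s, g m • clockSeq m,
    Submodule.sum_mem _ fun m _ => Submodule.smul_mem _ _ (clockSeq_int_mem_trigSpan m), ?_⟩
  filter_upwards [tendsto_evenPos.eventually_ge_atTop M₀] with N hN
  simpa [Finset.sum_apply, clockSeq] using h N.1 hN

/-- The block construction preserves the normalised norm and turns an integral clock of half size
into a full clock of even frequency, so an approximation at size N/2 transfers to size N. -/
lemma blkClockSeq_mem_posObs (κ : ℝ) : blkClockSeq κ ∈ posObs := by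
  intro ε hε
  obtain ⟨s, g, M₀, h⟩ := exists_clock_sum_near κ hε
  refine ⟨∑ m ∈ s, g m • clockSeq ((2 * m : ℤ) : ℝ),
    Submodule.sum_mem _ fun m _ => Submodule.smul_mem _ _ (clockSeq_int_mem_trigSpan _), ?_⟩
  filter_upwards [tendsto_evenPos_half.eventually_ge_atTop M₀] with N hN
  have h1 := h (N.1 / 2) hN
  rw [← hs_blk, blk_sub, blk_sum] at h1
  simpa [Finset.sum_apply, clockSeq, blkClockSeq, blk_smul, blk_clock] using h1

/-- Unitarity of `B` makes right multiplication isometric for `hs`, which is not a norm for which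
products are continuous uniformly in N. The left factor is then reduced to an integral clock, which
is unitary and maps `trigSpan` to itself. -/
lemma mul_mem_posObs {A B : OpSeq} (hA : A ∈ posObs) (hB : B ∈ posObs) (hBu : IsUnitarySeq B) :
    A * B ∈ posObs := by
  have hclock : ∀ m : ℤ, clockSeq m * B ∈ posObs := by
    intro m
    refine map_mem_asympClosure (LinearMap.mulLeft ℂ (clockSeq m)) ?_ ?_ hB
    · intro A N
      rw [LinearMap.mulLeft_apply, Pi.mul_apply, hs_unitary_mul (isUnitarySeq_clockSeq m N)]
    · intro A hA
      refine le_asympClosure _ ?_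
      induction hA using Submodule.span_induction with
      | mem x hx =>
        obtain ⟨l, rfl⟩ := hx
        have : clockSeq m * clockSeq l = clockSeq ((m + l : ℤ) : ℝ) := by
          funext N
          simp [clockSeq, clock_add]
        rw [LinearMap.mulLeft_apply, this]
        exact clockSeq_int_mem_trigSpan _
      | zero => simp
      | add x y _ _ hx hy => rw [map_add]; exact Submodule.add_mem _ hx hy
      | smul c x _ hx => rw [map_smul]; exact Submodule.smul_mem _ _ hx
  refine asympClosure_idem _ fun ε hε => ?_
  obtain ⟨A', hA', h⟩ := hA ε hε
  refine ⟨A' * B, ?_, ?_⟩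
  · have : trigSpan ≤ posObs.comap (LinearMap.mulRight ℂ B) := by
      refine Submodule.span_le.2 ?_
      rintro _ ⟨m, rfl⟩
      exact hclock m
    exact this hA'
  · filter_upwards [h] with N h
    rwa [Pi.mul_apply, Pi.mul_apply, ← Matrix.sub_mul, hs_mul_unitary (hBu N)]

lemma heisSeq_clockSeq (m : ℤ) : AsympEq (heisSeq (clockSeq m)) (clockSeq ((2 * m : ℤ) : ℝ)) := by
  refine AsympEq.of_le (tendsto_sqrt_div_evenPos (8 * |(m : ℝ)|)) fun N => ?_
  simpa [heisSeq_apply, clockSeq] using hs_heis_clock_sub_le N m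

lemma heisSeq_mem_posObs {A : OpSeq} (hA : A ∈ posObs) : heisSeq A ∈ posObs := by
  refine map_mem_asympClosure heisSeq (fun A N => (hs_heis (A N)).le) ?_ hA
  have : trigSpan ≤ posObs.comap heisSeq := by
    refine Submodule.span_le.2 ?_
    rintro _ ⟨m, rfl⟩
    exact (heisSeq_clockSeq m).mem_asympClosure (clockSeq_int_mem_posObs _)
  exact fun A hA => this hA

lemma heisSeq_iterate_mem_posObs {A : OpSeq} (hA : A ∈ posObs) (t : ℕ) :
    heisSeq^[t] A ∈ posObs := by
  induction t with
  | zero => exact hA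
  | succ t ih => rw [Function.iterate_succ_apply']; exact heisSeq_mem_posObs ih

lemma IsUnitarySeq.heisSeq_iterate {A : OpSeq} (hA : IsUnitarySeq A) (t : ℕ) :
    IsUnitarySeq (QuantumBaker.heisSeq^[t] A) := by
  induction t with
  | zero => exact hA
  | succ t ih => rw [Function.iterate_succ_apply']; exact ih.heisSeq

/-! ### Momentum observables -/

/-- The sequence of momentum clock matrices. -/
def momSeq (κ : ℝ) : OpSeq := fun N => momClock N.1 κ

lemma hs_momClock_sub_sum (M : ℕ) (κ : ℝ) (s : Finset ℤ) (g : ℤ → ℂ) :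
    hs (momClock M κ - ∑ m ∈ s, g m • shift M (-m)) = hs (clock M κ - ∑ m ∈ s, g m • clock M m) := by
  have h : momClock M κ - ∑ m ∈ s, g m • shift M (-m) =
      (dft M).conjTranspose * (clock M κ - ∑ m ∈ s, g m • clock M m) * dft M := by
    simp only [momClock, shift_neg_eq_conj_clock, Matrix.mul_sub, Matrix.sub_mul, Matrix.mul_sum,
      Matrix.sum_mul, Matrix.mul_smul, Matrix.smul_mul]
  rw [h, hs_mul_unitary (dft_unitary M), hs_unitary_mul (unitaryGroup_conjTranspose (dft_unitary M))]

lemma blk_momClock_asympEq (κ : ℝ) :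
    AsympEq (fun N => blk N (momClock (N.1 / 2) κ)) (momSeq κ) := by
  refine AsympEq.of_eventually_le fun ε hε => ?_
  -- One combination of shifts approximates the momentum operator at both sizes N/2 and N, leaving
  -- finitely many integral shifts to compare.
  obtain ⟨s, g, M₀, h⟩ := exists_clock_sum_near κ (show 0 < ε / 3 by positivity)
  have hlim : Tendsto (fun N : EvenPos => ∑ m ∈ s, ‖g m‖ *
      Real.sqrt (8 * |((-m : ℤ) : ℝ)| / N.1)) atTop (𝓝 0) := by
    have := tendsto_finsetSum s fun m _ =>
      (tendsto_sqrt_div_evenPos (8 * |((-m : ℤ) : ℝ)|)).const_mul ‖g m‖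
    simpa using this
  filter_upwards [tendsto_evenPos_half.eventually_ge_atTop M₀,
    tendsto_evenPos.eventually_ge_atTop M₀,
    hlim.eventually_lt_const (show 0 < ε / 3 by positivity)] with N h1 h2 h3
  have k1 : hs (blk N (momClock (N.1 / 2) κ) - ∑ m ∈ s, g m • blk N (shift (N.1 / 2) (-m))) ≤
      ε / 3 := by
    have := h _ h1
    rw [← hs_momClock_sub_sum, ← hs_blk, blk_sub, blk_sum] at this
    simpa only [blk_smul] using this
  have k2 : hs (∑ m ∈ s, g m • shift N.1 (-m) - momSeq κ N) ≤ ε / 3 := by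
    have := h _ h2
    rwa [← hs_momClock_sub_sum, hs_sub_comm] at this
  have k3 : hs (∑ m ∈ s, g m • blk N (shift (N.1 / 2) (-m)) - ∑ m ∈ s, g m • shift N.1 (-m)) ≤
      ε / 3 := by
    rw [← Finset.sum_sub_distrib]
    refine (hs_sum_le _ _).trans (le_trans (Finset.sum_le_sum fun m _ => ?_) h3.le)
    rw [← smul_sub, hs_smul]
    gcongr
    exact hs_blk_shift_sub_le N (-m)
  have := hs_sub_le (blk N (momClock (N.1 / 2) κ))
    (∑ m ∈ s, g m • blk N (shift (N.1 / 2) (-m))) (momSeq κ N)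
  have := hs_sub_le (∑ m ∈ s, g m • blk N (shift (N.1 / 2) (-m)))
    (∑ m ∈ s, g m • shift N.1 (-m)) (momSeq κ N)
  linarith

lemma heisSeq_momSeq (κ : ℝ) :
    AsympEq (heisSeq (momSeq κ)) (clockSeq κ * blkClockSeq (-(κ / 2)) * momSeq (κ / 2)) := by
  have h : heisSeq (momSeq κ) = clockSeq κ * blkClockSeq (-(κ / 2)) *
      fun N => blk N (momClock (N.1 / 2) (κ / 2)) := by
    funext N
    exact heis_momClock N κ
  rw [h]
  exact (blk_momClock_asympEq (κ / 2)).mul_left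
    ((isUnitarySeq_clockSeq κ).mul (isUnitarySeq_blkClockSeq _))

/-- Under the evolution a momentum observable becomes a position observable times a momentum
observable of exponentially small frequency. -/
lemma heisSeq_iterate_momSeq (κ : ℝ) (t : ℕ) :
    ∃ A ∈ posObs, IsUnitarySeq A ∧
      AsympEq (heisSeq^[t] (momSeq κ)) (A * momSeq (κ / 2 ^ t)) := by
  induction t with
  | zero =>
    refine ⟨1, one_mem_posObs, fun N => one_mem _, ?_⟩
    simpa using AsympEq.refl _
  | succ t ih =>
    obtain ⟨A, hA, hAu, h⟩ := ih
    set κ' := κ / 2 ^ t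
    have hu : IsUnitarySeq (clockSeq κ' * blkClockSeq (-(κ' / 2))) :=
      (isUnitarySeq_clockSeq κ').mul (isUnitarySeq_blkClockSeq _)
    refine ⟨heisSeq A * (clockSeq κ' * blkClockSeq (-(κ' / 2))), ?_, hAu.heisSeq.mul hu, ?_⟩
    · exact mul_mem_posObs (heisSeq_mem_posObs hA)
        (mul_mem_posObs (clockSeq_mem_posObs _) (blkClockSeq_mem_posObs _)
          (isUnitarySeq_blkClockSeq _)) hu
    · rw [Function.iterate_succ_apply']
      refine h.heisSeq.trans ?_
      rw [heisSeq_mul, mul_assoc, show κ / 2 ^ (t + 1) = κ' / 2 by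
        rw [pow_succ, ← div_div]]
      exact (heisSeq_momSeq κ').mul_left hAu.heisSeq

lemma hs_momClock_sub_one_le (M : ℕ) (κ : ℝ) : hs (momClock M κ - 1) ≤ 2 * Real.pi * |κ| := by
  have h : momClock M κ - 1 = (dft M).conjTranspose * (clock M κ - 1) * dft M := by
    rw [momClock, Matrix.mul_sub, Matrix.sub_mul, Matrix.mul_one,
      conjTranspose_mul_self_of_unitary (dft_unitary M)]
  rw [h, hs_mul_unitary (dft_unitary M),
    hs_unitary_mul (unitaryGroup_conjTranspose (dft_unitary M)), clock, ← Matrix.diagonal_one,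
    Matrix.diagonal_sub]
  apply hs_diagonal_le (by positivity)
  intro n
  refine (norm_e_sub_one_le _).trans ?_
  have hM : (0 : ℝ) < M := by exact_mod_cast n.pos
  rw [mul_div_assoc, abs_mul]
  have h1 : |((n : ℕ) : ℝ) / M| ≤ 1 := by
    rw [abs_of_nonneg (by positivity), div_le_one hM]
    exact_mod_cast n.2.le
  have : |κ| * |((n : ℕ) : ℝ) / M| ≤ |κ| := mul_le_of_le_one_right (abs_nonneg _) h1
  gcongr

section Ergodicity

/-! ### Quantum variance -/

section Expectation

variable {n : ℕ} (A B : Matrix (Fin n) (Fin n) ℂ) (ψ : QState n)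

lemma expectation_add : expectation (A + B) ψ = expectation A ψ + expectation B ψ := by
  simp [expectation]

lemma expectation_smul (c : ℂ) : expectation (c • A) ψ = c * expectation A ψ := by
  simp [expectation]

lemma expectation_zero : expectation (0 : Matrix (Fin n) (Fin n) ℂ) ψ = 0 := by
  simp [expectation]

lemma expectation_one : expectation (1 : Matrix (Fin n) (Fin n) ℂ) ψ = (‖ψ‖ : ℂ) ^ 2 := by
  simp [expectation, inner_self_eq_norm_sq_to_K]

lemma inner_toEuclideanLin_conjTranspose (ψ χ : QState n) :
    inner ℂ ψ (Matrix.toEuclideanLin A.conjTranspose χ) =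
      inner ℂ (Matrix.toEuclideanLin A ψ) χ := by
  rw [Matrix.toEuclideanLin_conjTranspose_eq_adjoint, LinearMap.adjoint_inner_right]

lemma toEuclideanLin_mul_apply :
    Matrix.toEuclideanLin (A * B) ψ = Matrix.toEuclideanLin A (Matrix.toEuclideanLin B ψ) := by
  simp [Matrix.toLpLin_apply, Matrix.mulVec_mulVec]

lemma norm_toEuclideanLin_unitary {U : Matrix (Fin n) (Fin n) ℂ}
    (hU : U ∈ Matrix.unitaryGroup (Fin n) ℂ) : ‖Matrix.toEuclideanLin U ψ‖ = ‖ψ‖ := by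
  have h : inner ℂ (Matrix.toEuclideanLin U ψ) (Matrix.toEuclideanLin U ψ) = inner ℂ ψ ψ := by
    rw [← inner_toEuclideanLin_conjTranspose, ← toEuclideanLin_mul_apply,
      conjTranspose_mul_self_of_unitary hU]
    simp
  rw [inner_self_eq_norm_sq_to_K, inner_self_eq_norm_sq_to_K] at h
  have h' : ‖Matrix.toEuclideanLin U ψ‖ ^ 2 = ‖ψ‖ ^ 2 := by exact_mod_cast h
  exact (sq_eq_sq₀ (norm_nonneg _) (norm_nonneg _)).1 h'

lemma norm_expectation_le_of_unitary {U : Matrix (Fin n) (Fin n) ℂ}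
    (hU : U ∈ Matrix.unitaryGroup (Fin n) ℂ) (hψ : ‖ψ‖ = 1) : ‖expectation U ψ‖ ≤ 1 := by
  refine (norm_inner_le_norm _ _).trans ?_
  rw [norm_toEuclideanLin_unitary ψ hU, hψ, one_mul]

/-- The eigenvalue has modulus 1, and its phase cancels between the two slots of the inner product.
-/
lemma expectation_conj_of_eigenvector {U : Matrix (Fin n) (Fin n) ℂ}
    (hU : U ∈ Matrix.unitaryGroup (Fin n) ℂ) (hψ : ‖ψ‖ = 1) {μ : ℂ}
    (hμ : Matrix.toEuclideanLin U ψ = μ • ψ) :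
    expectation (U.conjTranspose * A * U) ψ = expectation A ψ := by
  have h1 : ‖μ‖ = 1 := by
    have := norm_toEuclideanLin_unitary ψ hU
    rw [hμ, norm_smul, hψ, mul_one] at this
    exact this
  rw [expectation, Matrix.mul_assoc, toEuclideanLin_mul_apply, inner_toEuclideanLin_conjTranspose,
    toEuclideanLin_mul_apply, hμ, map_smul, inner_smul_left, inner_smul_right, ← mul_assoc,
    mul_comm _ μ, Complex.mul_conj', h1]
  simp [expectation]

end Expectation

lemma sum_norm_div_le_hs {n : ℕ} (A : Matrix (Fin n) (Fin n) ℂ) (x : Fin n → ℂ)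
    (hx : ∑ j, ‖x j‖ ^ 2 ≤ hsSq A) : (∑ j, ‖x j‖) / n ≤ hs A := by
  rcases Nat.eq_zero_or_pos n with rfl | hn
  · simp [hs]
  have hn' : (0 : ℝ) < n := by positivity
  rw [hs, Fintype.card_fin]
  apply Real.le_sqrt_of_sq_le
  have h := sq_sum_le_card_mul_sum_sq (s := Finset.univ) (f := fun j => ‖x j‖)
  rw [Finset.card_univ, Fintype.card_fin] at h
  rw [div_pow, div_le_div_iff₀ (by positivity) hn']
  calc (∑ j, ‖x j‖) ^ 2 * n ≤ (n * ∑ j, ‖x j‖ ^ 2) * n := by gcongr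
    _ ≤ (n * hsSq A) * n := by gcongr
    _ = hsSq A * (n : ℝ) ^ 2 := by ring

lemma norm_trace_div_le_hs {n : ℕ} (A : Matrix (Fin n) (Fin n) ℂ) : ‖A.trace / n‖ ≤ hs A := by
  refine le_trans ?_ (sum_norm_div_le_hs A (fun j => A j j) ?_)
  · rw [norm_div, Complex.norm_natCast]
    gcongr
    exact norm_sum_le _ _
  · exact Finset.sum_le_sum fun i _ =>
      Finset.single_le_sum (f := fun j => ‖A i j‖ ^ 2) (fun j _ => by positivity)
        (Finset.mem_univ i)

/-- Parseval's identity, applied to each row of `A`, shows that the Hilbert–Schmidt norm does not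
depend on the basis. -/
lemma sum_norm_sq_toEuclideanLin {n : ℕ} (b : OrthonormalBasis (Fin n) ℂ (QState n))
    (A : Matrix (Fin n) (Fin n) ℂ) :
    ∑ j, ‖Matrix.toEuclideanLin A (b j)‖ ^ 2 = hsSq A := by
  have h : ∀ i j, (Matrix.toEuclideanLin A (b j)) i =
      inner ℂ (WithLp.toLp 2 fun k => star (A i k) : QState n) (b j) := by
    intro i j
    rw [PiLp.inner_apply]
    simp [Matrix.toLpLin_apply, Matrix.mulVec, dotProduct, mul_comm]
  simp only [EuclideanSpace.norm_sq_eq, h]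
  rw [Finset.sum_comm]
  refine Finset.sum_congr rfl fun i _ => ?_
  rw [b.sum_sq_norm_inner_left, EuclideanSpace.norm_sq_eq]
  simp

lemma sum_norm_expectation_div_le {n : ℕ} (b : OrthonormalBasis (Fin n) ℂ (QState n))
    (A : Matrix (Fin n) (Fin n) ℂ) : (∑ j, ‖expectation A (b j)‖) / n ≤ hs A := by
  apply sum_norm_div_le_hs
  rw [← sum_norm_sq_toEuclideanLin b]
  gcongr with j
  refine (norm_inner_le_norm _ _).trans ?_
  rw [b.orthonormal.norm_eq_one, one_mul]

/-- The mean absolute deviation of the diagonal matrix elements from the normalised trace. -/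
def meanDev {n : ℕ} (b : OrthonormalBasis (Fin n) ℂ (QState n)) (A : Matrix (Fin n) (Fin n) ℂ) :
    ℝ :=
  (∑ j, ‖expectation A (b j) - A.trace / n‖) / n

section MeanDev

variable {n : ℕ} (b : OrthonormalBasis (Fin n) ℂ (QState n)) (A B : Matrix (Fin n) (Fin n) ℂ)

lemma meanDev_nonneg : 0 ≤ meanDev b A := by
  unfold meanDev; positivity

lemma meanDev_add_le : meanDev b (A + B) ≤ meanDev b A + meanDev b B := by
  rw [meanDev, meanDev, meanDev, ← add_div, ← Finset.sum_add_distrib]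
  gcongr with j
  rw [expectation_add, Matrix.trace_add, add_div, add_sub_add_comm]
  exact norm_add_le _ _

lemma meanDev_smul (c : ℂ) : meanDev b (c • A) = ‖c‖ * meanDev b A := by
  simp only [meanDev, expectation_smul, Matrix.trace_smul, smul_eq_mul, mul_div_assoc, ← mul_sub,
    norm_mul, ← Finset.mul_sum]

lemma meanDev_zero : meanDev b 0 = 0 := by
  simp [meanDev, expectation_zero]

/-- One `hs A` bounds the mean of the diagonal elements, the other the normalised trace. -/
lemma meanDev_le : meanDev b A ≤ 2 * hs A := by
  rcases Nat.eq_zero_or_pos n with rfl | hn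
  · simpa [meanDev] using hs_nonneg A
  calc meanDev b A ≤ (∑ j, (‖expectation A (b j)‖ + ‖A.trace / n‖)) / n := by
        unfold meanDev
        gcongr with j
        exact norm_sub_le _ _
    _ = (∑ j, ‖expectation A (b j)‖) / n + ‖A.trace / n‖ := by
        have : (n : ℝ) ≠ 0 := by positivity
        rw [Finset.sum_add_distrib, add_div, Finset.sum_const, Finset.card_univ, Fintype.card_fin,
          nsmul_eq_mul, mul_div_cancel_left₀ _ this]
    _ ≤ 2 * hs A := by
        have h1 := sum_norm_expectation_div_le b A
        have h2 := norm_trace_div_le_hs A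
        linarith

lemma meanDev_one : meanDev b 1 = 0 := by
  rcases Nat.eq_zero_or_pos n with rfl | hn
  · simp [meanDev]
  have : (n : ℂ) ≠ 0 := by exact_mod_cast hn.ne'
  simp [meanDev, expectation_one, b.orthonormal.norm_eq_one, Matrix.trace_one, this]

end MeanDev

/-! ### Ergodic sequences -/

/-- A family of orthonormal bases. -/
abbrev BasisSeq : Type := ∀ N : EvenPos, OrthonormalBasis (Fin N.1) ℂ (QState N.1)

/-- All vectors of the bases are eigenvectors of the quantised baker's map. -/
def IsEigenbasisSeq (φ : BasisSeq) : Prop :=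
  ∀ (N : EvenPos) (j : Fin N.1), ∃ μ : ℂ,
    Matrix.toEuclideanLin (bakerOp N) (φ N j) = μ • φ N j

/-- The operator sequences whose diagonal matrix elements concentrate at the normalised trace. -/
def ergodicSeqs (φ : BasisSeq) : Submodule ℂ OpSeq where
  carrier := {A | Tendsto (fun N => meanDev (φ N) (A N)) atTop (𝓝 0)}
  zero_mem' := by simpa [meanDev_zero] using tendsto_const_nhds
  add_mem' := by
    intro A B hA hB
    exact squeeze_zero (fun _ => meanDev_nonneg _ _) (fun N => meanDev_add_le _ _ _)
      (by simpa using Tendsto.add hA hB)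
  smul_mem' := by
    intro c A hA
    have h := Tendsto.const_mul ‖c‖ hA
    rw [mul_zero] at h
    simpa only [Set.mem_ofPred_eq, Pi.smul_apply, meanDev_smul] using h

variable {φ : BasisSeq}

lemma mem_ergodicSeqs {A : OpSeq} :
    A ∈ ergodicSeqs φ ↔ Tendsto (fun N => meanDev (φ N) (A N)) atTop (𝓝 0) := Iff.rfl

lemma asympClosure_ergodicSeqs : asympClosure (ergodicSeqs φ) ≤ ergodicSeqs φ := by
  intro A hA
  refine Metric.tendsto_nhds.2 fun ε hε => ?_
  obtain ⟨B, hB, h⟩ := hA (ε / 4) (by positivity)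
  filter_upwards [h, (mem_ergodicSeqs.1 hB).eventually_lt_const (show 0 < ε / 2 by positivity)]
    with N h1 h2
  rw [Real.dist_0_eq_abs, abs_of_nonneg (meanDev_nonneg _ _)]
  have h3 := meanDev_add_le (φ N) (A N - B N) (B N)
  rw [sub_add_cancel] at h3
  have h4 := meanDev_le (φ N) (A N - B N)
  linarith

lemma AsympEq.mem_ergodicSeqs {A B : OpSeq} (h : AsympEq A B) (hB : B ∈ ergodicSeqs φ) :
    A ∈ ergodicSeqs φ :=
  asympClosure_ergodicSeqs fun _ hε => ⟨B, hB, h.eventually_le hε⟩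

lemma trace_heisSeq_iterate (A : OpSeq) (t : ℕ) (N : EvenPos) :
    (heisSeq^[t] A N).trace = (A N).trace := by
  induction t with
  | zero => rfl
  | succ t ih =>
    rw [Function.iterate_succ_apply', heisSeq_apply, heis, Matrix.trace_mul_comm,
      ← Matrix.mul_assoc, mul_conjTranspose_self_of_unitary (bakerOp_unitary N), Matrix.one_mul,
      ih]

lemma expectation_heisSeq_iterate (hφ : IsEigenbasisSeq φ) (A : OpSeq) (t : ℕ) (N : EvenPos)
    (j : Fin N.1) : expectation (heisSeq^[t] A N) (φ N j) = expectation (A N) (φ N j) := by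
  induction t with
  | zero => rfl
  | succ t ih =>
    obtain ⟨μ, hμ⟩ := hφ N j
    rw [Function.iterate_succ_apply', heisSeq_apply, heis, expectation_conj_of_eigenvector _ _
      (bakerOp_unitary N) ((φ N).orthonormal.norm_eq_one j) hμ, ih]

lemma meanDev_heisSeq_iterate (hφ : IsEigenbasisSeq φ) (A : OpSeq) (t : ℕ) (N : EvenPos) :
    meanDev (φ N) (heisSeq^[t] A N) = meanDev (φ N) (A N) := by
  simp only [meanDev, trace_heisSeq_iterate, expectation_heisSeq_iterate hφ]

/-- Averaging over time does not change the diagonal matrix elements. -/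
lemma meanDev_sum_heisSeq_iterate (hφ : IsEigenbasisSeq φ) (A : OpSeq) (n : ℕ) (N : EvenPos) :
    meanDev (φ N) (∑ t ∈ Finset.range n, heisSeq^[t] A N) = n * meanDev (φ N) (A N) := by
  have h3 : ∀ j, expectation (∑ t ∈ Finset.range n, heisSeq^[t] A N) (φ N j) =
      n * expectation (A N) (φ N j) := by
    intro j
    induction n with
    | zero => simp [expectation_zero]
    | succ n ih =>
      rw [Finset.sum_range_succ, expectation_add, ih, expectation_heisSeq_iterate hφ]
      push_cast
      ring
  have h4 : (∑ t ∈ Finset.range n, heisSeq^[t] A N).trace = n * (A N).trace := by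
    rw [Matrix.trace_sum]
    simp [trace_heisSeq_iterate]
  simp only [meanDev, h3, h4, mul_div_assoc, ← mul_sub, norm_mul, Complex.norm_natCast,
    ← Finset.mul_sum]

lemma heisSeq_iterate_clockSeq (m : ℤ) (t : ℕ) :
    AsympEq (heisSeq^[t] (clockSeq m)) (clockSeq ((2 ^ t * m : ℤ) : ℝ)) := by
  induction t with
  | zero => simpa using AsympEq.refl _
  | succ t ih =>
    rw [Function.iterate_succ_apply', pow_succ', mul_assoc]
    exact ih.heisSeq.trans (heisSeq_clockSeq _)

/-- Orthogonality of the clock matrices. -/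
lemma hs_sum_clock_eq {n M : ℕ} (hM : 0 < M) (f : ℕ → ℤ)
    (hf : ∀ s < n, ∀ t < n, s ≠ t → ¬ (M : ℤ) ∣ f t - f s) :
    hs (∑ t ∈ Finset.range n, clock M (f t)) = Real.sqrt n := by
  have hM' : (M : ℝ) ≠ 0 := by positivity
  have h : hsSq (∑ t ∈ Finset.range n, clock M (f t)) = n * M := by
    apply Complex.ofReal_injective
    rw [hsSq_eq_trace, Matrix.conjTranspose_sum, Finset.sum_mul_sum, Matrix.trace_sum]
    have hterm : ∀ s ∈ Finset.range n, (∑ t ∈ Finset.range n,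
        (clock M (f s)).conjTranspose * clock M (f t)).trace = M := by
      intro s hs
      rw [Matrix.trace_sum, Finset.sum_eq_single s]
      · rw [conjTranspose_mul_self_of_unitary (clock_unitary M _), Matrix.trace_one,
          Fintype.card_fin]
      · intro t ht hts
        rw [clock_conjTranspose, ← clock_add,
          show (-(f s : ℝ) + f t) = ((f t - f s : ℤ) : ℝ) by push_cast; ring]
        exact trace_clock (hf s (Finset.mem_range.1 hs) t (Finset.mem_range.1 ht) hts.symm) hM
      · intro h; exact absurd hs h
    rw [Finset.sum_congr rfl hterm]
    simp
  rw [hs, h, Fintype.card_fin, mul_div_cancel_right₀ _ hM']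

lemma eventually_hs_sum_clock {m : ℤ} (hm : m ≠ 0) (n : ℕ) :
    ∀ᶠ N : EvenPos in atTop,
      hs (∑ t ∈ Finset.range n, clock N.1 ((2 ^ t * m : ℤ) : ℝ)) = Real.sqrt n := by
  -- This size of N keeps the non-zero differences (2^t - 2^s)m below N in absolute value, so N
  -- cannot divide them.
  filter_upwards [tendsto_evenPos.eventually_gt_atTop (2 ^ n * m.natAbs)] with N hN
  refine hs_sum_clock_eq N.2.1 (fun t => 2 ^ t * m) fun s hs t ht hst hd => ?_
  rw [← sub_mul] at hd
  have hle : ∀ r < n, (2 : ℤ) ^ r ≤ 2 ^ n := fun r hr =>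
    pow_le_pow_right₀ (by norm_num) hr.le
  have h0 : ∀ r : ℕ, (0 : ℤ) < 2 ^ r := fun r => by positivity
  have hlt : |((2 : ℤ) ^ t - 2 ^ s) * m| < N.1 := by
    rw [abs_mul]
    have h1 : |(2 : ℤ) ^ t - 2 ^ s| ≤ 2 ^ n := by
      rw [abs_le]
      constructor <;> linarith [hle s hs, hle t ht, h0 s, h0 t]
    calc |(2 : ℤ) ^ t - 2 ^ s| * |m| ≤ 2 ^ n * |m| := by gcongr
      _ < N.1 := by
        rw [Int.abs_eq_natAbs]
        exact_mod_cast hN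
  have := Int.eq_zero_of_abs_lt_dvd hd hlt
  rcases mul_eq_zero.1 this with h | h
  · apply hst
    have : (2 : ℤ) ^ t = 2 ^ s := sub_eq_zero.1 h
    exact (Nat.pow_right_injective le_rfl (by exact_mod_cast this)).symm
  · exact hm h

/-- Summing n evolved copies multiplies the mean deviation by n, yet the norm of the sum grows only
like √n, because the copies are asymptotically orthogonal clocks of distinct frequencies. -/
lemma clockSeq_mem_ergodicSeqs (hφ : IsEigenbasisSeq φ) (m : ℤ) : clockSeq m ∈ ergodicSeqs φ := by
  by_cases hm : m = 0
  · subst hm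
    rw [mem_ergodicSeqs]
    simpa [clockSeq, meanDev_one] using tendsto_const_nhds
  refine Metric.tendsto_nhds.2 fun ε hε => ?_
  -- The sum has norm at most 2√n once the evolution errors are below √n; `meanDev_le` doubles this,
  -- and n > 16/ε² says 4√n < nε.
  obtain ⟨n, hn⟩ := exists_nat_gt (16 / ε ^ 2)
  have hn0 : (0 : ℝ) < n := lt_trans (by positivity) hn
  have hlim : Tendsto (fun N : EvenPos => ∑ t ∈ Finset.range n,
      hs (heisSeq^[t] (clockSeq m) N - clockSeq ((2 ^ t * m : ℤ) : ℝ) N)) atTop (𝓝 0) := by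
    simpa using tendsto_finsetSum (Finset.range n) fun t _ => heisSeq_iterate_clockSeq m t
  filter_upwards [eventually_hs_sum_clock hm n,
    hlim.eventually_lt_const (Real.sqrt_pos.2 hn0)] with N h1 h2
  rw [Real.dist_0_eq_abs, abs_of_nonneg (meanDev_nonneg _ _)]
  have h3 : hs (∑ t ∈ Finset.range n, heisSeq^[t] (clockSeq m) N) ≤ 2 * Real.sqrt n := by
    have h4 := hs_sum_le (Finset.range n) fun t =>
      heisSeq^[t] (clockSeq m) N - clockSeq ((2 ^ t * m : ℤ) : ℝ) N
    rw [Finset.sum_sub_distrib] at h4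
    have h5 := hs_add_le (∑ t ∈ Finset.range n, heisSeq^[t] (clockSeq m) N -
      ∑ t ∈ Finset.range n, clockSeq ((2 ^ t * m : ℤ) : ℝ) N)
      (∑ t ∈ Finset.range n, clockSeq ((2 ^ t * m : ℤ) : ℝ) N)
    rw [sub_add_cancel] at h5
    have h6 : hs (∑ t ∈ Finset.range n, clockSeq ((2 ^ t * m : ℤ) : ℝ) N) = Real.sqrt n := h1
    linarith
  have h7 := meanDev_le (φ N) (∑ t ∈ Finset.range n, heisSeq^[t] (clockSeq m) N)
  rw [meanDev_sum_heisSeq_iterate hφ] at h7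
  have h8 : 4 * Real.sqrt n < n * ε := by
    rw [div_lt_iff₀ (by positivity)] at hn
    have h9 : 4 < Real.sqrt n * ε := by
      have : Real.sqrt ((4 : ℝ) ^ 2) < Real.sqrt (n * ε ^ 2) :=
        Real.sqrt_lt_sqrt (by positivity) (by linarith)
      rwa [Real.sqrt_sq (by norm_num), Real.sqrt_mul hn0.le, Real.sqrt_sq hε.le] at this
    have h10 := Real.mul_self_sqrt hn0.le
    have h11 := Real.sqrt_pos.2 hn0
    nlinarith
  have h12 : n * meanDev (φ N) (clockSeq m N) < n * ε := by linarith
  exact lt_of_mul_lt_mul_left h12 hn0.le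

lemma posObs_le_ergodicSeqs (hφ : IsEigenbasisSeq φ) : posObs ≤ ergodicSeqs φ := by
  refine (asympClosure_mono ?_).trans asympClosure_ergodicSeqs
  refine Submodule.span_le.2 ?_
  rintro _ ⟨m, rfl⟩
  exact clockSeq_mem_ergodicSeqs hφ m

/-- The mean deviation is invariant under evolution, so the approximation may be made at any time;
the time may depend on ε but not on N. -/
lemma mem_ergodicSeqs_of_heisSeq_iterate (hφ : IsEigenbasisSeq φ) {A : OpSeq}
    (h : ∀ ε > 0, ∃ t : ℕ, ∃ B ∈ ergodicSeqs φ, ∀ᶠ N in atTop, hs (heisSeq^[t] A N - B N) ≤ ε) :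
    A ∈ ergodicSeqs φ := by
  refine Metric.tendsto_nhds.2 fun ε hε => ?_
  obtain ⟨t, B, hB, h⟩ := h (ε / 4) (by positivity)
  filter_upwards [h, (mem_ergodicSeqs.1 hB).eventually_lt_const (show 0 < ε / 2 by positivity)]
    with N h1 h2
  rw [Real.dist_0_eq_abs, abs_of_nonneg (meanDev_nonneg _ _), ← meanDev_heisSeq_iterate hφ _ t]
  have h3 := meanDev_add_le (φ N) (heisSeq^[t] A N - B N) (B N)
  rw [sub_add_cancel] at h3
  have h4 := meanDev_le (φ N) (heisSeq^[t] A N - B N)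
  linarith

lemma heisSeq_iterate_mul (A B : OpSeq) (t : ℕ) :
    heisSeq^[t] (A * B) = heisSeq^[t] A * heisSeq^[t] B := by
  induction t with
  | zero => rfl
  | succ t ih => simp only [Function.iterate_succ_apply', ih, heisSeq_mul]

lemma clockSeq_mul_momSeq_mem_ergodicSeqs (hφ : IsEigenbasisSeq φ) (m : ℤ) (κ : ℝ) :
    clockSeq m * momSeq κ ∈ ergodicSeqs φ := by
  refine mem_ergodicSeqs_of_heisSeq_iterate hφ fun ε hε => ?_
  -- At this time 2π|κ|/2^t ≤ ε/2, so dropping the momentum factor costs ε/2; the other ε/2 is the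
  -- asymptotic evolution error.
  obtain ⟨t, ht⟩ := pow_unbounded_of_one_lt (4 * Real.pi * |κ| / ε) one_lt_two
  obtain ⟨A, hA, hAu, h⟩ := heisSeq_iterate_momSeq κ t
  set C := heisSeq^[t] (clockSeq m) with hC
  have hCu : IsUnitarySeq C := (isUnitarySeq_clockSeq _).heisSeq_iterate t
  refine ⟨t, C * A, posObs_le_ergodicSeqs hφ (mul_mem_posObs
    (heisSeq_iterate_mem_posObs (clockSeq_int_mem_posObs m) t) hA hAu), ?_⟩
  filter_upwards [(h.mul_left hCu).eventually_le (half_pos hε)] with N hN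
  rw [heisSeq_iterate_mul]
  refine (hs_sub_le _ ((C * (A * momSeq (κ / 2 ^ t))) N) _).trans ?_
  have h1 : hs ((C * (A * momSeq (κ / 2 ^ t))) N - (C * A) N) ≤ ε / 2 := by
    have : (C * (A * momSeq (κ / 2 ^ t))) N - (C * A) N =
        C N * (A N * (momClock N.1 (κ / 2 ^ t) - 1)) := by
      simp only [Pi.mul_apply, Matrix.mul_sub, Matrix.mul_one, momSeq]
    rw [this, hs_unitary_mul (hCu N), hs_unitary_mul (hAu N)]
    refine (hs_momClock_sub_one_le _ _).trans ?_
    rw [abs_div, abs_of_pos (show (0 : ℝ) < 2 ^ t by positivity), ← mul_div_assoc,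
      div_le_iff₀ (by positivity)]
    rw [div_lt_iff₀ hε] at ht
    linarith
  linarith

/-! ### Weyl translations -/

lemma weylTranslation_eq (M : ℕ) (k : ℤ × ℤ) :
    weylTranslation M k = e (-(k.1 * k.2) / (2 * M)) • (clock M k.2 * shift M k.1) := by
  ext i j
  rw [weylTranslation, Matrix.of_apply, Matrix.smul_apply, clock, Matrix.diagonal_mul, shift,
    Matrix.of_apply, smul_eq_mul]
  split_ifs
  · rw [mul_one, e, e]
    congr 2
    · push_cast
      have : (M : ℂ) ≠ 0 := by exact_mod_cast i.pos.ne'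
      field_simp
    · push_cast
      ring
  · simp

lemma shift_eq_momClock (M : ℕ) (m : ℤ) : shift M m = momClock M (-m : ℤ) := by
  rw [momClock, ← shift_neg_eq_conj_clock, neg_neg]

lemma weylTranslation_unitary (M : ℕ) (k : ℤ × ℤ) :
    weylTranslation M k ∈ Matrix.unitaryGroup (Fin M) ℂ := by
  rw [weylTranslation_eq, Matrix.mem_unitaryGroup_iff, star_smul, Matrix.smul_mul,
    Matrix.mul_smul, smul_smul, star_e, e_mul_neg, one_smul]
  exact Matrix.mem_unitaryGroup_iff.1 (mul_mem (clock_unitary M _) (shift_unitary M _))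

lemma trace_weylTranslation {M : ℕ} {k : ℤ × ℤ} (hk : k ≠ 0) (h1 : |k.1| < M) (h2 : |k.2| < M) :
    (weylTranslation M k).trace = 0 := by
  have hM : 0 < M := by
    have := abs_nonneg k.1
    omega
  have hshift : ∀ i : Fin M, shift M k.1 i i = if k.1 = 0 then 1 else 0 := by
    intro i
    rw [shift, Matrix.of_apply]
    have : (((i : ℕ) : ℤ) ≡ ((i : ℕ) : ℤ) + k.1 [ZMOD (M : ℤ)]) ↔ k.1 = 0 := by
      constructor
      · intro h
        have hd := h.dvd
        rw [add_sub_cancel_left] at hd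
        exact Int.eq_zero_of_abs_lt_dvd hd h1
      · intro h; simp [h]
    simp only [this]
  rw [weylTranslation_eq, Matrix.trace_smul]
  by_cases h : k.1 = 0
  · have hk2 : k.2 ≠ 0 := fun h' => hk (Prod.ext h h')
    have : (clock M k.2 * shift M k.1).trace = (clock M k.2).trace := by
      simp only [Matrix.trace, Matrix.diag_apply, clock, Matrix.diagonal_mul, hshift, if_pos h,
        mul_one, Matrix.diagonal_apply_eq]
    rw [this, trace_clock _ hM, smul_zero]
    intro hd
    exact hk2 (Int.eq_zero_of_abs_lt_dvd hd h2)
  · simp only [Matrix.trace, Matrix.diag_apply, clock, Matrix.diagonal_mul, hshift, if_neg h,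
      mul_zero, Finset.sum_const_zero, smul_zero]

/-- The Weyl translations are ergodic: the diagonal matrix elements tend to zero in mean. -/
lemma tendsto_mean_weylTranslation (hφ : IsEigenbasisSeq φ) {k : ℤ × ℤ} (hk : k ≠ 0) :
    Tendsto (fun N : EvenPos =>
      (∑ j, ‖expectation (weylTranslation N.1 k) (φ N j)‖) / (N.1 : ℝ)) atTop (𝓝 0) := by
  have h := mem_ergodicSeqs.1 (clockSeq_mul_momSeq_mem_ergodicSeqs hφ k.2 (-k.1 : ℤ))
  refine h.congr' ?_
  -- Once N exceeds |k₁| and |k₂| the trace vanishes, and the mean deviation is the mean of the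
  -- absolute diagonal elements.
  filter_upwards [tendsto_evenPos.eventually_gt_atTop k.1.natAbs,
    tendsto_evenPos.eventually_gt_atTop k.2.natAbs] with N h1 h2
  have hd : meanDev (φ N) ((clockSeq k.2 * momSeq (-k.1 : ℤ)) N) =
      meanDev (φ N) (weylTranslation N.1 k) := by
    rw [weylTranslation_eq, meanDev_smul, norm_e, one_mul, shift_eq_momClock]
    rfl
  rw [hd, meanDev, trace_weylTranslation hk (by rw [Int.abs_eq_natAbs]; exact_mod_cast h1)
    (by rw [Int.abs_eq_natAbs]; exact_mod_cast h2)]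
  simp

end Ergodicity

/-! ### Decay of Fourier coefficients -/

lemma torusIntegral_eq_iterated {f : ℝ × ℝ → ℂ} (hf : Continuous f) :
    torusIntegral f = ∫ q in (0 : ℝ)..1, ∫ p in (0 : ℝ)..1, f (q, p) := by
  have hint : IntegrableOn f (Set.Ico (0 : ℝ) 1 ×ˢ Set.Ico (0 : ℝ) 1)
      ((volume : Measure ℝ).prod volume) :=
    (hf.continuousOn.integrableOn_compact (isCompact_Icc.prod isCompact_Icc)).mono_set
      (Set.prod_mono Set.Ico_subset_Icc_self Set.Ico_subset_Icc_self)
  rw [torusIntegral, Measure.volume_eq_prod, setIntegral_prod _ hint,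
    intervalIntegral.integral_of_le zero_le_one, integral_Ico_eq_integral_Ioc]
  refine integral_congr_ae (Eventually.of_forall fun q => ?_)
  simp only
  rw [intervalIntegral.integral_of_le zero_le_one, integral_Ico_eq_integral_Ioc]

lemma torusIntegral_eq_iterated_symm {f : ℝ × ℝ → ℂ} (hf : Continuous f) :
    torusIntegral f = ∫ p in (0 : ℝ)..1, ∫ q in (0 : ℝ)..1, f (q, p) := by
  rw [torusIntegral_eq_iterated hf]
  simp only [intervalIntegral.integral_of_le zero_le_one]
  refine integral_integral_swap (f := fun q p => f (q, p)) ?_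
  rw [Measure.prod_restrict]
  exact (hf.continuousOn.integrableOn_compact (isCompact_Icc.prod isCompact_Icc)).mono_set
      (Set.prod_mono Set.Ioc_subset_Icc_self Set.Ioc_subset_Icc_self)

lemma continuous_fderiv_apply_of_contDiff {f : ℝ × ℝ → ℂ} (hf : ContDiff ℝ 1 f) (v : ℝ × ℝ) :
    Continuous fun x => fderiv ℝ f x v :=
  (hf.continuous_fderiv one_ne_zero).clm_apply continuous_const

lemma torusIntegral_fderiv_fst {f : ℝ × ℝ → ℂ} (hf : ContDiff ℝ 1 f)
    (hper : ∀ p, f (1, p) = f (0, p)) :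
    torusIntegral (fun x => fderiv ℝ f x (1, 0)) = 0 := by
  have hc := continuous_fderiv_apply_of_contDiff hf (1, 0)
  rw [torusIntegral_eq_iterated_symm hc]
  have h : ∀ p : ℝ, ∫ q in (0 : ℝ)..1, fderiv ℝ f (q, p) (1, 0) = 0 := by
    intro p
    have hd : ∀ q : ℝ, HasDerivAt (fun q : ℝ => f (q, p)) (fderiv ℝ f (q, p) (1, 0)) q := by
      intro q
      have h1 : HasDerivAt (fun q : ℝ => (q, p)) ((1 : ℝ), (0 : ℝ)) q :=
        (hasDerivAt_id q).prodMk (hasDerivAt_const q p)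
      exact ((hf.differentiable one_ne_zero (q, p)).hasFDerivAt).comp_hasDerivAt q h1
    rw [intervalIntegral.integral_eq_sub_of_hasDerivAt (fun q _ => hd q)
      ((hc.comp (continuous_id.prodMk continuous_const)).intervalIntegrable _ _), hper, sub_self]
  simp [h]

lemma torusIntegral_fderiv_snd {f : ℝ × ℝ → ℂ} (hf : ContDiff ℝ 1 f)
    (hper : ∀ q, f (q, 1) = f (q, 0)) :
    torusIntegral (fun x => fderiv ℝ f x (0, 1)) = 0 := by
  have hc := continuous_fderiv_apply_of_contDiff hf (0, 1)
  rw [torusIntegral_eq_iterated hc]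
  have h : ∀ q : ℝ, ∫ p in (0 : ℝ)..1, fderiv ℝ f (q, p) (0, 1) = 0 := by
    intro q
    have hd : ∀ p : ℝ, HasDerivAt (fun p : ℝ => f (q, p)) (fderiv ℝ f (q, p) (0, 1)) p := by
      intro p
      have h1 : HasDerivAt (fun p : ℝ => (q, p)) ((0 : ℝ), (1 : ℝ)) p :=
        (hasDerivAt_const p q).prodMk (hasDerivAt_id p)
      exact ((hf.differentiable one_ne_zero (q, p)).hasFDerivAt).comp_hasDerivAt p h1
    rw [intervalIntegral.integral_eq_sub_of_hasDerivAt (fun q _ => hd q)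
      ((hc.comp (continuous_const.prodMk continuous_id)).intervalIntegrable _ _), hper, sub_self]
  simp [h]

lemma torusIntegral_add {f g : ℝ × ℝ → ℂ} (hf : Continuous f) (hg : Continuous g) :
    torusIntegral (fun x => f x + g x) = torusIntegral f + torusIntegral g := by
  have hint : ∀ {f : ℝ × ℝ → ℂ}, Continuous f →
      IntegrableOn f (Set.Ico (0 : ℝ) 1 ×ˢ Set.Ico (0 : ℝ) 1) volume := fun hf =>
    (hf.continuousOn.integrableOn_compact (isCompact_Icc.prod isCompact_Icc)).mono_set
      (Set.prod_mono Set.Ico_subset_Icc_self Set.Ico_subset_Icc_self)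
  exact integral_add (hint hf) (hint hg)

lemma torusIntegral_const_mul (c : ℂ) (f : ℝ × ℝ → ℂ) :
    torusIntegral (fun x => c * f x) = c * torusIntegral f :=
  integral_const_mul c _

lemma norm_torusIntegral_le {f : ℝ × ℝ → ℂ} {C : ℝ}
    (hC : ∀ x ∈ Set.Icc (0 : ℝ) 1 ×ˢ Set.Icc (0 : ℝ) 1, ‖f x‖ ≤ C) :
    ‖torusIntegral f‖ ≤ C := by
  have hvol : (volume : Measure (ℝ × ℝ)) (Set.Ico (0 : ℝ) 1 ×ˢ Set.Ico (0 : ℝ) 1) = 1 := by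
    rw [Measure.volume_eq_prod, Measure.prod_prod]
    simp
  have h := norm_setIntegral_le_of_norm_le_const (μ := (volume : Measure (ℝ × ℝ)))
    (s := Set.Ico (0 : ℝ) 1 ×ˢ Set.Ico (0 : ℝ) 1) (f := f) (C := C) (by rw [hvol]; simp)
    fun x hx => hC x (Set.prod_mono Set.Ico_subset_Icc_self Set.Ico_subset_Icc_self hx)
  simpa [torusIntegral, Measure.real, hvol] using h

lemma IsSmoothOnTorus.fderiv_apply {a : ℝ × ℝ → ℂ} (ha : IsSmoothOnTorus a) (v : ℝ × ℝ) :
    IsSmoothOnTorus fun x => fderiv ℝ a x v where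
  contDiff := (ha.contDiff.fderiv_right (m := ∞) le_rfl).clm_apply contDiff_const
  periodic q p m n := by
    have h : (fun x : ℝ × ℝ => a (x + ((m : ℝ), (n : ℝ)))) = a := by
      funext x
      exact ha.periodic x.1 x.2 m n
    have h2 := fderiv_comp_add_right (𝕜 := ℝ) (f := a) (x := (q, p)) ((m : ℝ), (n : ℝ))
    rw [h] at h2
    have h3 : fderiv ℝ a (q + m, p + n) = fderiv ℝ a (q, p) := h2.symm
    rw [h3]

/-- The complex conjugate of the Fourier mode. -/
lemma conj_fourierMode (k : ℤ × ℤ) (x : ℝ × ℝ) :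
    (starRingEnd ℂ) (fourierMode k x) =
      Complex.exp (2 * Real.pi * Complex.I * (x.2 * k.1 - x.1 * k.2)) := by
  rw [fourierMode, ← Complex.exp_conj]
  congr 1
  rw [show 2 * Real.pi * Complex.I * (x.1 * k.2 - x.2 * k.1) =
    ((2 * Real.pi * (x.1 * k.2 - x.2 * k.1) : ℝ) : ℂ) * Complex.I by push_cast; ring,
    map_mul, Complex.conj_I, Complex.conj_ofReal]
  push_cast
  ring

lemma norm_conj_fourierMode (k : ℤ × ℤ) (x : ℝ × ℝ) :
    ‖(starRingEnd ℂ) (fourierMode k x)‖ = 1 := by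
  rw [conj_fourierMode, show 2 * Real.pi * Complex.I * (x.2 * k.1 - x.1 * k.2) =
    ((2 * Real.pi * (x.2 * k.1 - x.1 * k.2) : ℝ) : ℂ) * Complex.I by push_cast; ring,
    Complex.norm_exp_ofReal_mul_I]

lemma hasFDerivAt_conj_fourierMode (k : ℤ × ℤ) (x : ℝ × ℝ) :
    ∃ L : ℝ × ℝ →L[ℝ] ℂ, HasFDerivAt (fun x => (starRingEnd ℂ) (fourierMode k x)) L x ∧
      ∀ v : ℝ × ℝ, L v = (2 * Real.pi * Complex.I * (v.2 * k.1 - v.1 * k.2)) *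
        (starRingEnd ℂ) (fourierMode k x) := by
  let l : ℝ × ℝ →L[ℝ] ℂ := (2 * Real.pi * Complex.I : ℂ) •
    ((k.1 : ℂ) • (Complex.ofRealCLM.comp (ContinuousLinearMap.snd ℝ ℝ ℝ)) -
      (k.2 : ℂ) • (Complex.ofRealCLM.comp (ContinuousLinearMap.fst ℝ ℝ ℝ)))
  have hl : ∀ v, l v = 2 * Real.pi * Complex.I * (v.2 * k.1 - v.1 * k.2) := by
    intro v
    simp [l]
    ring
  have h := (l.hasFDerivAt (x := x)).cexp
  refine ⟨Complex.exp (l x) • l, ?_, ?_⟩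
  · simpa only [conj_fourierMode, ← hl] using h
  · intro v
    rw [smul_apply, smul_eq_mul, mul_comm, hl, hl, conj_fourierMode]

lemma contDiff_conj_fourierMode (k : ℤ × ℤ) :
    ContDiff ℝ ∞ fun x => (starRingEnd ℂ) (fourierMode k x) := by
  simp only [conj_fourierMode]
  refine ContDiff.cexp (contDiff_const.mul (ContDiff.sub (ContDiff.mul ?_ contDiff_const)
    (ContDiff.mul ?_ contDiff_const)))
  · exact Complex.ofRealCLM.contDiff.comp contDiff_snd
  · exact Complex.ofRealCLM.contDiff.comp contDiff_fst

lemma conj_fourierMode_periodic (k : ℤ × ℤ) (q p : ℝ) (m n : ℤ) :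
    (starRingEnd ℂ) (fourierMode k (q + m, p + n)) = (starRingEnd ℂ) (fourierMode k (q, p)) := by
  rw [conj_fourierMode, conj_fourierMode, Complex.exp_eq_exp_iff_exists_int]
  refine ⟨n * k.1 - m * k.2, ?_⟩
  push_cast
  ring

lemma fderiv_conj_fourierMode_mul {a : ℝ × ℝ → ℂ} (ha : IsSmoothOnTorus a) (k : ℤ × ℤ)
    (v x : ℝ × ℝ) :
    fderiv ℝ (fun x => (starRingEnd ℂ) (fourierMode k x) * a x) x v =
      (2 * Real.pi * Complex.I * (v.2 * k.1 - v.1 * k.2)) *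
        ((starRingEnd ℂ) (fourierMode k x) * a x) +
      (starRingEnd ℂ) (fourierMode k x) * fderiv ℝ a x v := by
  obtain ⟨L, hL, hLv⟩ := hasFDerivAt_conj_fourierMode k x
  have hda : HasFDerivAt a (fderiv ℝ a x) x :=
    (ha.contDiff.differentiable (by simp) x).hasFDerivAt
  have hm : HasFDerivAt (fun x => (starRingEnd ℂ) (fourierMode k x) * a x) _ x := hL.mul hda
  rw [hm.fderiv]
  simp only [add_apply, smul_apply, smul_eq_mul, hLv]
  ring

/-- Integration by parts, with `h0` expressing that the boundary terms cancel. -/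
lemma torusFourierCoeff_fderiv_aux {a : ℝ × ℝ → ℂ} (ha : IsSmoothOnTorus a) (k : ℤ × ℤ)
    (v : ℝ × ℝ)
    (h0 : torusIntegral (fun x => fderiv ℝ
      (fun x => (starRingEnd ℂ) (fourierMode k x) * a x) x v) = 0) :
    torusFourierCoeff (fun x => fderiv ℝ a x v) k =
      -(2 * Real.pi * Complex.I * (v.2 * k.1 - v.1 * k.2)) * torusFourierCoeff a k := by
  have hc1 := (contDiff_conj_fourierMode k).continuous
  simp only [fderiv_conj_fourierMode_mul ha] at h0
  have hc2 : Continuous fun x => (2 * Real.pi * Complex.I * (v.2 * k.1 - v.1 * k.2)) *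
      ((starRingEnd ℂ) (fourierMode k x) * a x) :=
    continuous_const.mul (hc1.mul ha.contDiff.continuous)
  have hc3 : Continuous fun x => (starRingEnd ℂ) (fourierMode k x) * fderiv ℝ a x v :=
    hc1.mul (ha.fderiv_apply v).contDiff.continuous
  rw [torusIntegral_add hc2 hc3, torusIntegral_const_mul] at h0
  rw [torusFourierCoeff, torusFourierCoeff, neg_mul]
  exact eq_neg_of_add_eq_zero_right h0

lemma IsSmoothOnTorus.conj_fourierMode_mul {a : ℝ × ℝ → ℂ} (ha : IsSmoothOnTorus a) (k : ℤ × ℤ) :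
    IsSmoothOnTorus fun x => (starRingEnd ℂ) (fourierMode k x) * a x where
  contDiff := (contDiff_conj_fourierMode k).mul ha.contDiff
  periodic q p m n := by rw [conj_fourierMode_periodic, ha.periodic]

lemma torusFourierCoeff_fderiv_fst {a : ℝ × ℝ → ℂ} (ha : IsSmoothOnTorus a) (k : ℤ × ℤ) :
    torusFourierCoeff (fun x => fderiv ℝ a x (1, 0)) k =
      2 * Real.pi * Complex.I * k.2 * torusFourierCoeff a k := by
  rw [torusFourierCoeff_fderiv_aux ha]
  · push_cast
    ring
  · have h := ha.conj_fourierMode_mul k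
    refine torusIntegral_fderiv_fst (h.contDiff.of_le (by simp)) fun p => ?_
    simpa using h.periodic 0 p 1 0

lemma torusFourierCoeff_fderiv_snd {a : ℝ × ℝ → ℂ} (ha : IsSmoothOnTorus a) (k : ℤ × ℤ) :
    torusFourierCoeff (fun x => fderiv ℝ a x (0, 1)) k =
      -(2 * Real.pi * Complex.I * k.1) * torusFourierCoeff a k := by
  rw [torusFourierCoeff_fderiv_aux ha]
  · push_cast
    ring
  · have h := ha.conj_fourierMode_mul k
    refine torusIntegral_fderiv_snd (h.contDiff.of_le (by simp)) fun q => ?_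
    simpa using h.periodic q 0 0 1

lemma IsSmoothOnTorus.exists_norm_torusFourierCoeff_le {a : ℝ × ℝ → ℂ} (ha : IsSmoothOnTorus a) :
    ∃ C, ∀ k, ‖torusFourierCoeff a k‖ ≤ C := by
  obtain ⟨C, hC⟩ := (isCompact_Icc.prod isCompact_Icc :
    IsCompact (Set.Icc (0 : ℝ) 1 ×ˢ Set.Icc (0 : ℝ) 1)).exists_bound_of_continuousOn
    ha.contDiff.continuous.continuousOn
  refine ⟨C, fun k => norm_torusIntegral_le fun x hx => ?_⟩
  rw [norm_mul, norm_conj_fourierMode, one_mul]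
  exact hC x hx

/-- The witness is the second derivative in p, the variable dual to k₁; the factor (2π)² ≥ 1 is
discarded. -/
lemma exists_sq_mul_norm_le_fst {a : ℝ × ℝ → ℂ} (ha : IsSmoothOnTorus a) :
    ∃ b : ℝ × ℝ → ℂ, IsSmoothOnTorus b ∧
      ∀ k, (k.1 : ℝ) ^ 2 * ‖torusFourierCoeff a k‖ ≤ ‖torusFourierCoeff b k‖ := by
  refine ⟨_, (ha.fderiv_apply (0, 1)).fderiv_apply (0, 1), fun k => ?_⟩
  rw [torusFourierCoeff_fderiv_snd (ha.fderiv_apply _), torusFourierCoeff_fderiv_snd ha]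
  simp only [norm_mul, norm_neg, Complex.norm_I, Complex.norm_intCast, mul_one,
    Complex.norm_real, Real.norm_of_nonneg Real.pi_pos.le, Complex.norm_ofNat]
  rw [← mul_assoc]
  gcongr
  rw [← sq_abs (k.1 : ℝ)]
  have := Real.pi_gt_three
  have h2 : (1 : ℝ) ≤ (2 * Real.pi) ^ 2 := by nlinarith
  nlinarith [sq_nonneg |(k.1 : ℝ)|]

lemma exists_sq_mul_norm_le_snd {a : ℝ × ℝ → ℂ} (ha : IsSmoothOnTorus a) :
    ∃ b : ℝ × ℝ → ℂ, IsSmoothOnTorus b ∧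
      ∀ k, (k.2 : ℝ) ^ 2 * ‖torusFourierCoeff a k‖ ≤ ‖torusFourierCoeff b k‖ := by
  refine ⟨_, (ha.fderiv_apply (1, 0)).fderiv_apply (1, 0), fun k => ?_⟩
  rw [torusFourierCoeff_fderiv_fst (ha.fderiv_apply _), torusFourierCoeff_fderiv_fst ha]
  simp only [norm_mul, Complex.norm_I, Complex.norm_intCast, mul_one,
    Complex.norm_real, Real.norm_of_nonneg Real.pi_pos.le, Complex.norm_ofNat]
  rw [← mul_assoc]
  gcongr
  rw [← sq_abs (k.2 : ℝ)]
  have := Real.pi_gt_three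
  have h2 : (1 : ℝ) ≤ (2 * Real.pi) ^ 2 := by nlinarith
  nlinarith [sq_nonneg |(k.2 : ℝ)|]

lemma summable_inv_one_add_sq : Summable fun m : ℤ => (1 + (m : ℝ) ^ 2)⁻¹ := by
  refine Summable.of_norm_bounded_eventually
    (Real.summable_one_div_int_pow.2 (le_refl 2)) ?_
  filter_upwards [(Set.finite_singleton (0 : ℤ)).compl_mem_cofinite] with m hm
  have hm' : (m : ℝ) ≠ 0 := by exact_mod_cast hm
  rw [Real.norm_of_nonneg (by positivity), one_div]
  gcongr
  linarith

lemma summable_weight :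
    Summable fun k : ℤ × ℤ => (1 + (k.1 : ℝ) ^ 2)⁻¹ * (1 + (k.2 : ℝ) ^ 2)⁻¹ :=
  summable_inv_one_add_sq.mul_of_nonneg summable_inv_one_add_sq
    (fun m => by positivity) fun m => by positivity

/-- The Fourier coefficients of a smooth function are absolutely summable. -/
lemma IsSmoothOnTorus.summable_norm_torusFourierCoeff {a : ℝ × ℝ → ℂ} (ha : IsSmoothOnTorus a) :
    Summable fun k => ‖torusFourierCoeff a k‖ := by
  obtain ⟨b, hb, hab⟩ := exists_sq_mul_norm_le_fst ha
  obtain ⟨c, hc, hac⟩ := exists_sq_mul_norm_le_snd ha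
  obtain ⟨d, hd, hbd⟩ := exists_sq_mul_norm_le_snd hb
  obtain ⟨C₀, h0⟩ := ha.exists_norm_torusFourierCoeff_le
  obtain ⟨C₁, h1⟩ := hb.exists_norm_torusFourierCoeff_le
  obtain ⟨C₂, h2⟩ := hc.exists_norm_torusFourierCoeff_le
  obtain ⟨C₃, h3⟩ := hd.exists_norm_torusFourierCoeff_le
  refine Summable.of_nonneg_of_le (fun k => norm_nonneg _) (fun k => ?_)
    (summable_weight.mul_left (C₀ + C₁ + C₂ + C₃))
  -- Expanding (1 + k₁²)(1 + k₂²) gives four terms, bounded by the coefficients of a, of its second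
  -- derivatives in p and in q, and of the mixed fourth derivative.
  rw [← mul_inv, ← div_eq_mul_inv, le_div_iff₀ (by positivity)]
  have e1 := hab k
  have e2 := hac k
  have e3 := hbd k
  have e4 := mul_le_mul_of_nonneg_left e1 (sq_nonneg (k.2 : ℝ))
  nlinarith [h0 k, h1 k, h2 k, h3 k]

section GoodIndices

/-! ### Quantum ergodicity -/

lemma weylTranslation_zero (M : ℕ) : weylTranslation M 0 = 1 := by
  rw [weylTranslation_eq, shift_eq_momClock]
  simp [momClock, conjTranspose_mul_self_of_unitary (dft_unitary M)]

lemma torusFourierCoeff_zero (a : ℝ × ℝ → ℂ) : torusFourierCoeff a 0 = torusIntegral a := by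
  simp [torusFourierCoeff, fourierMode]

lemma norm_apply_le_one_of_unitary {n : ℕ} {U : Matrix (Fin n) (Fin n) ℂ}
    (hU : U ∈ Matrix.unitaryGroup (Fin n) ℂ) (i j : Fin n) : ‖U i j‖ ≤ 1 := by
  have h := Finset.single_le_sum (f := fun i => ‖U i j‖ ^ 2) (fun i _ => by positivity)
    (Finset.mem_univ i)
  rw [sum_norm_sq_col hU j] at h
  exact (sq_le_one_iff₀ (norm_nonneg _)).1 h

/-- The matrix elements of the Weyl quantisation as a sum over the Fourier coefficients. -/
lemma expectation_weylOp {a : ℝ × ℝ → ℂ} (ha : IsSmoothOnTorus a) (M : ℕ) (ψ : QState M) :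
    expectation (weylOp M a) ψ =
      ∑' k, torusFourierCoeff a k * expectation (weylTranslation M k) ψ := by
  have hsum : Summable fun k => torusFourierCoeff a k • weylTranslation M k := by
    refine Pi.summable.2 fun i => Pi.summable.2 fun j => ?_
    refine Summable.of_norm_bounded ha.summable_norm_torusFourierCoeff fun k => ?_
    rw [Matrix.smul_apply, norm_smul]
    exact mul_le_of_le_one_right (norm_nonneg _)
      (norm_apply_le_one_of_unitary (weylTranslation_unitary M k) i j)
  let L : Matrix (Fin M) (Fin M) ℂ →ₗ[ℂ] ℂ :=
    { toFun := fun A => expectation A ψ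
      map_add' := fun A B => expectation_add A B ψ
      map_smul' := fun c A => expectation_smul A ψ c }
  have hL : Continuous L := L.continuous_of_finiteDimensional
  have h := (hsum.hasSum.map L hL).tsum_eq
  have h2 : ∀ k, (L ∘ fun k => torusFourierCoeff a k • weylTranslation M k) k =
      torusFourierCoeff a k * expectation (weylTranslation M k) ψ := fun k =>
    expectation_smul _ _ _
  simp only [h2] at h
  exact h.symm

/-- The summable positive weights on the frequencies. -/
def weight (k : ℤ × ℤ) : ℝ := (1 + (k.1 : ℝ) ^ 2)⁻¹ * (1 + (k.2 : ℝ) ^ 2)⁻¹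

lemma weight_pos (k : ℤ × ℤ) : 0 < weight k := by
  unfold weight; positivity

/-- The size of the diagonal matrix element of a non-trivial Weyl translation. -/
def elementSize {n : ℕ} (ψ : QState n) (k : ℤ × ℤ) : ℝ :=
  if k = 0 then 0 else ‖expectation (weylTranslation n k) ψ‖

lemma elementSize_nonneg {n : ℕ} (ψ : QState n) (k : ℤ × ℤ) : 0 ≤ elementSize ψ k := by
  unfold elementSize; split_ifs <;> positivity

lemma elementSize_le_one {n : ℕ} {ψ : QState n} (hψ : ‖ψ‖ = 1) (k : ℤ × ℤ) :
    elementSize ψ k ≤ 1 := by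
  unfold elementSize
  split_ifs
  · exact zero_le_one
  · exact norm_expectation_le_of_unitary ψ (weylTranslation_unitary n k) hψ

/-- The weighted deviation of a state from equidistribution. -/
def deviation {n : ℕ} (ψ : QState n) : ℝ := ∑' k, weight k * elementSize ψ k

lemma summable_weight_mul_elementSize {n : ℕ} {ψ : QState n} (hψ : ‖ψ‖ = 1) :
    Summable fun k => weight k * elementSize ψ k :=
  Summable.of_nonneg_of_le (fun k => mul_nonneg (weight_pos k).le (elementSize_nonneg ψ k))
    (fun k => mul_le_of_le_one_right (weight_pos k).le (elementSize_le_one hψ k)) summable_weight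

lemma deviation_nonneg {n : ℕ} (ψ : QState n) : 0 ≤ deviation ψ :=
  tsum_nonneg fun k => mul_nonneg (weight_pos k).le (elementSize_nonneg ψ k)

lemma weight_mul_elementSize_le {n : ℕ} {ψ : QState n} (hψ : ‖ψ‖ = 1) (k : ℤ × ℤ) :
    weight k * elementSize ψ k ≤ deviation ψ :=
  (summable_weight_mul_elementSize hψ).le_tsum k fun l _ =>
    mul_nonneg (weight_pos l).le (elementSize_nonneg ψ l)

variable {φ : BasisSeq}

/-- The mean of the deviation over a basis. -/
def meanDeviation (φ : BasisSeq) (N : EvenPos) : ℝ := (∑ j, deviation (φ N j)) / (N.1 : ℝ)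

lemma meanDeviation_nonneg (φ : BasisSeq) (N : EvenPos) : 0 ≤ meanDeviation φ N :=
  div_nonneg (Finset.sum_nonneg fun _ _ => deviation_nonneg _) (Nat.cast_nonneg _)

/-- Each frequency contributes a mean tending to zero and never exceeding 1, so the summable weights
dominate the series uniformly in N. -/
lemma tendsto_meanDeviation (hφ : IsEigenbasisSeq φ) :
    Tendsto (meanDeviation φ) atTop (𝓝 0) := by
  have hnorm : ∀ N j, ‖φ N j‖ = 1 := fun N j => (φ N).orthonormal.norm_eq_one j
  have h : ∀ N, meanDeviation φ N =
      ∑' k, weight k * ((∑ j, elementSize (φ N j) k) / (N.1 : ℝ)) := by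
    intro N
    simp only [meanDeviation, deviation]
    rw [← Summable.tsum_finsetSum fun j _ => summable_weight_mul_elementSize (hnorm N j),
      ← tsum_div_const]
    simp only [Finset.mul_sum, mul_div_assoc, Finset.sum_div]
  have hlim := tendsto_tsum_of_dominated_convergence (𝓕 := (atTop : Filter EvenPos))
    (f := fun N k => weight k * ((∑ j, elementSize (φ N j) k) / (N.1 : ℝ))) (g := fun _ => 0)
    (bound := weight) summable_weight ?_ ?_
  · simpa only [tsum_zero, ← h] using hlim
  · intro k
    have h0 : Tendsto (fun N : EvenPos => (∑ j, elementSize (φ N j) k) / (N.1 : ℝ)) atTop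
        (𝓝 0) := by
      by_cases hk : k = 0
      · simpa [elementSize, hk] using tendsto_const_nhds
      · simpa only [elementSize, if_neg hk] using tendsto_mean_weylTranslation hφ hk
    simpa using h0.const_mul (weight k)
  · refine Eventually.of_forall fun N k => ?_
    have hN : (0 : ℝ) < N.1 := by exact_mod_cast N.2.1
    have h1 : (∑ j, elementSize (φ N j) k) / (N.1 : ℝ) ≤ 1 := by
      rw [div_le_one hN]
      calc ∑ j, elementSize (φ N j) k ≤ ∑ _j : Fin N.1, (1 : ℝ) := by
            gcongr with j
            exact elementSize_le_one (hnorm N j) k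
        _ = N.1 := by simp
    have h2 : 0 ≤ (∑ j, elementSize (φ N j) k) / (N.1 : ℝ) :=
      div_nonneg (Finset.sum_nonneg fun _ _ => elementSize_nonneg _ _) hN.le
    rw [Real.norm_of_nonneg (mul_nonneg (weight_pos k).le h2)]
    exact mul_le_of_le_one_right (weight_pos k).le h1

/-- The threshold for the deviation defining the good states. -/
def threshold (φ : BasisSeq) (N : EvenPos) : ℝ :=
  meanDeviation φ N + Real.sqrt (meanDeviation φ N) + 1 / (N.1 : ℝ)

lemma tendsto_sqrt_meanDeviation (hφ : IsEigenbasisSeq φ) :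
    Tendsto (fun N => Real.sqrt (meanDeviation φ N)) atTop (𝓝 0) := by
  have h := (Real.continuous_sqrt.tendsto 0).comp (tendsto_meanDeviation hφ)
  rw [Real.sqrt_zero] at h
  exact h

lemma tendsto_threshold (hφ : IsEigenbasisSeq φ) : Tendsto (threshold φ) atTop (𝓝 0) := by
  have h : Tendsto (fun N : EvenPos => 1 / (N.1 : ℝ)) atTop (𝓝 0) :=
    tendsto_const_nhds.div_atTop (tendsto_natCast_atTop_atTop.comp tendsto_evenPos)
  have h2 := ((tendsto_meanDeviation hφ).add (tendsto_sqrt_meanDeviation hφ)).add h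
  rw [add_zero, add_zero] at h2
  exact h2

/-- The indices of the equidistributed eigenstates. -/
def goodIndices (φ : BasisSeq) (N : EvenPos) : Finset (Fin N.1) :=
  Finset.univ.filter fun j => deviation (φ N j) ≤ threshold φ N

lemma mem_goodIndices {N : EvenPos} {j : Fin N.1} :
    j ∈ goodIndices φ N ↔ deviation (φ N j) ≤ threshold φ N := by
  simp [goodIndices]

lemma sum_deviation_eq (φ : BasisSeq) (N : EvenPos) :
    ∑ j, deviation (φ N j) = N.1 * meanDeviation φ N := by
  have hN : (N.1 : ℝ) ≠ 0 := by exact_mod_cast N.2.1.ne'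
  rw [meanDeviation, mul_div_cancel₀ _ hN]

lemma goodIndices_nonempty (φ : BasisSeq) (N : EvenPos) : (goodIndices φ N).Nonempty := by
  have : Nonempty (Fin N.1) := ⟨⟨0, N.2.1⟩⟩
  obtain ⟨j, -, hj⟩ := Finset.exists_le_of_sum_le (s := (Finset.univ : Finset (Fin N.1)))
    (f := fun j => deviation (φ N j)) (g := fun _ => meanDeviation φ N) Finset.univ_nonempty
    (by rw [sum_deviation_eq]; simp)
  refine ⟨j, mem_goodIndices.2 (hj.trans ?_)⟩
  have h1 := Real.sqrt_nonneg (meanDeviation φ N)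
  have h2 : 0 ≤ 1 / (N.1 : ℝ) := by positivity
  unfold threshold
  linarith

/-- Markov's inequality. With r² the mean deviation, the threshold is at least r, so at most Nr
indices are bad. The summand 1/N keeps the threshold positive when r = 0, and the summand r²
guarantees that some index is good. -/
lemma one_sub_sqrt_le_card_goodIndices (φ : BasisSeq) (N : EvenPos) :
    1 - Real.sqrt (meanDeviation φ N) ≤ ((goodIndices φ N).card : ℝ) / (N.1 : ℝ) := by
  have hN : (0 : ℝ) < N.1 := by exact_mod_cast N.2.1
  set r := Real.sqrt (meanDeviation φ N)
  have hr : 0 ≤ r := Real.sqrt_nonneg _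
  have hm := meanDeviation_nonneg φ N
  have hrr : r * r = meanDeviation φ N := Real.mul_self_sqrt hm
  have hpos : 0 < 1 / (N.1 : ℝ) := by positivity
  set B := Finset.univ.filter fun j => ¬ deviation (φ N j) ≤ threshold φ N
  have hcard : ((goodIndices φ N).card : ℝ) + B.card = N.1 := by
    have := Finset.card_filter_add_card_filter_not (s := (Finset.univ : Finset (Fin N.1)))
      fun j => deviation (φ N j) ≤ threshold φ N
    rw [Finset.card_univ, Fintype.card_fin] at this
    exact_mod_cast this
  have hB : B.card * threshold φ N ≤ N.1 * meanDeviation φ N := by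
    rw [← sum_deviation_eq, ← nsmul_eq_mul]
    refine (Finset.card_nsmul_le_sum B _ _ fun j hj => ?_).trans
      (Finset.sum_le_sum_of_subset_of_nonneg (Finset.subset_univ B)
        fun j _ _ => deviation_nonneg _)
    exact (not_le.1 (Finset.mem_filter.1 hj).2).le
  have hthr : 0 < threshold φ N := by unfold threshold; linarith
  have hle : N.1 * meanDeviation φ N ≤ (N.1 * r) * threshold φ N := by
    rw [mul_assoc]
    refine mul_le_mul_of_nonneg_left ?_ hN.le
    rw [← hrr]
    refine mul_le_mul_of_nonneg_left ?_ hr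
    unfold threshold
    linarith
  have hfin : (B.card : ℝ) ≤ N.1 * r := le_of_mul_le_mul_right (hB.trans hle) hthr
  rw [le_div_iff₀ hN]
  linarith

lemma tendsto_card_goodIndices (hφ : IsEigenbasisSeq φ) :
    Tendsto (fun N => ((goodIndices φ N).card : ℝ) / (N.1 : ℝ)) atTop (𝓝 1) := by
  refine tendsto_of_tendsto_of_tendsto_of_le_of_le (g := fun N =>
    1 - Real.sqrt (meanDeviation φ N)) ?_ tendsto_const_nhds
    (one_sub_sqrt_le_card_goodIndices φ) fun N => ?_
  · simpa using (tendsto_sqrt_meanDeviation hφ).const_sub 1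
  · have hN : (0 : ℝ) < N.1 := by exact_mod_cast N.2.1
    simp only
    rw [div_le_one hN]
    exact_mod_cast (Finset.card_le_univ _).trans (Fintype.card_fin _).le

lemma tendsto_expectation_weylTranslation (hφ : IsEigenbasisSeq φ) {j : ∀ N : EvenPos, Fin N.1}
    (hj : ∀ N, j N ∈ goodIndices φ N) {k : ℤ × ℤ} (hk : k ≠ 0) :
    Tendsto (fun N => expectation (weylTranslation N.1 k) (φ N (j N))) atTop (𝓝 0) := by
  refine squeeze_zero_norm (a := fun N => threshold φ N / weight k) (fun N => ?_)
    (by simpa using (tendsto_threshold hφ).div_const (weight k))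
  rw [le_div_iff₀ (weight_pos k), mul_comm]
  have h := weight_mul_elementSize_le ((φ N).orthonormal.norm_eq_one (j N)) k
  rw [elementSize, if_neg hk] at h
  exact h.trans (mem_goodIndices.1 (hj N))

lemma tendsto_expectation_weylOp (hφ : IsEigenbasisSeq φ) {j : ∀ N : EvenPos, Fin N.1}
    (hj : ∀ N, j N ∈ goodIndices φ N) {a : ℝ × ℝ → ℂ} (ha : IsSmoothOnTorus a) :
    Tendsto (fun N => expectation (weylOp N.1 a) (φ N (j N))) atTop (𝓝 (torusIntegral a)) := by
  simp only [expectation_weylOp ha]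
  have hnorm : ∀ N j, ‖φ N j‖ = 1 := fun N j => (φ N).orthonormal.norm_eq_one j
  -- Only k = 0 survives, and its Fourier coefficient is the integral of a; unitarity of the
  -- translations makes the summable coefficients a bound independent of N.
  have hlim := tendsto_tsum_of_dominated_convergence (𝓕 := (atTop : Filter EvenPos))
    (f := fun N k => torusFourierCoeff a k * expectation (weylTranslation N.1 k) (φ N (j N)))
    (g := fun k => if k = 0 then torusIntegral a else 0)
    (bound := fun k => ‖torusFourierCoeff a k‖) ha.summable_norm_torusFourierCoeff ?_ ?_
  · rwa [tsum_ite_eq] at hlim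
  · intro k
    by_cases hk : k = 0
    · subst hk
      simpa [weylTranslation_zero, expectation_one, hnorm, torusFourierCoeff_zero]
        using tendsto_const_nhds
    · rw [if_neg hk]
      simpa using (tendsto_expectation_weylTranslation hφ hj hk).const_mul (torusFourierCoeff a k)
  · refine Eventually.of_forall fun N k => ?_
    rw [norm_mul]
    exact mul_le_of_le_one_right (norm_nonneg _)
      (norm_expectation_le_of_unitary _ (weylTranslation_unitary N.1 k) (hnorm N _))

end GoodIndices

end QuantumBaker

end

theorem corollary1
    (φ : ∀ N : QuantumBaker.EvenPos,
      OrthonormalBasis (Fin N.1) ℂ (QuantumBaker.QState N.1))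
    (hφ : ∀ (N : QuantumBaker.EvenPos) (j : Fin N.1), ∃ μ : ℂ,
      Matrix.toEuclideanLin (QuantumBaker.bakerOp N) (φ N j) = μ • φ N j) :
    ∃ J : ∀ N : QuantumBaker.EvenPos, Finset (Fin N.1),
      (∀ N : QuantumBaker.EvenPos, (J N).Nonempty) ∧
      Tendsto (fun N : QuantumBaker.EvenPos => ((J N).card : ℝ) / (N.1 : ℝ)) atTop (𝓝 1) ∧
      ∀ a : ℝ × ℝ → ℂ, QuantumBaker.IsSmoothOnTorus a →
        ∀ j : (∀ N : QuantumBaker.EvenPos, Fin N.1), (∀ N, j N ∈ J N) →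
          Tendsto
            (fun N : QuantumBaker.EvenPos =>
              QuantumBaker.expectation (QuantumBaker.weylOp N.1 a) (φ N (j N)))
            atTop (𝓝 (QuantumBaker.torusIntegral a)) :=
  ⟨QuantumBaker.goodIndices φ, QuantumBaker.goodIndices_nonempty φ,
    QuantumBaker.tendsto_card_goodIndices hφ,
    fun _ ha _ hj => QuantumBaker.tendsto_expectation_weylOp hφ hj ha⟩
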